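/- Work in ZFC with classes. Throughout, embeddings $j\colon V\to M$ are elementary embeddings of the universe into a transitive class. For a cardinal $\kappa$ and an ordinal $\theta$, a *$\theta$-strongness embedding for $\kappa$* is such an embedding $j\colon V\to M$ with critical point $\kappa$ and $V_\theta\subseteq M$; $\kappa$ is *$\theta$-strong* if one exists. A function $\ell\colon\kappa\to V_\kappa$ is a *$\theta$-strongness Laver function* for $\kappa$ if for every $a\in V_\theta$ there is a $\theta$-strongness embedding $j$ for $\kappa$ with $j(\ell)(\kappa)=a$. A *$\theta$-strongness joint Laver sequence for $\kappa$ of length $\lambda$* is a sequence $\langle \ell_\alpha;\alpha<\lambda\rangle$ of $\theta$-strongness Laver functions for $\kappa$ such that for every sequence $\langle a_\alpha;\alpha<\lambda\rangle$ of elements of $V_\theta$ there is a single $\theta$-strongness embedding $j$ for $\kappa$ with $j(\ell_\alpha)(\kappa)=a_\alpha$ for all $\alpha<\lambda$. For a limit ordinal $\theta>\kappa$, a *$(\kappa,V_\theta)$-extender* is a system of measures on $V_\kappa$ of the form $E=\{(a,X) : a\in V_\theta,\ X\subseteq V_\kappa,\ a\in j(X)\}$ derived from some $\theta$-strongness embedding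 $j$ for $\kappa$ with $V_\theta\subseteq j(V_\kappa)$. The *$\theta$-strongness Mitchell order* for $\kappa$ is the relation on $(\kappa,V_\theta)$-extenders given by $E\triangleleft F$ iff $E$ is an element of the transitive collapse of the ultrapower of $V$ by $F$. When $\triangleleft$ is well-founded, the *$\theta$-strongness Mitchell rank* of $\kappa$ is its height, $\sup\{\operatorname{rank}_{\triangleleft}(E)+1 : E \text{ a } (\kappa,V_\theta)\text{-extender}\}$; the largest possible value of this rank is $\beth_\theta^+$. **Theorem.** Let $\kappa$ be a $\theta$-strong cardinal, where $\theta$ is a limit ordinal and $\operatorname{cf}(\theta)\leq\kappa<\theta$. If there is a $\theta$-strongness joint Laver sequence for $\kappa$ of length $\operatorname{cf}(\theta)$, then $\kappa$ has maximal $\theta$-strongness Mitchell rank: the order $\triangleleft$ is well-founded and the $\theta$-strongness Mitchell rank of $\kappa$ equals $\beth_\theta^+$. -/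

import Mathlib

universe u

open scoped ZFSet Cardinal

noncomputable section

namespace StrongLaver

/-- The only symbol of the language of set theory: a binary relation symbol. -/
inductive SetRel : ℕ → Type
  | mem : SetRel 2

/-- The first-order language of set theory. -/
def setLanguage : FirstOrder.Language.{0, 0} := ⟨fun _ => Empty, SetRel⟩

/-- The universe `V` as a structure: the symbol is interpreted by true membership. -/
instance universeStructure : setLanguage.Structure ZFSet.{u} where
  funMap := fun f => nomatch f
  RelMap := fun r x => match r with
    | SetRel.mem => x 0 ∈ x 1

/-- A class `M` of sets as a structure with true membership. -/
instance classStructure (M : Set ZFSet.{u}) : setLanguage.Structure M where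
  funMap := fun f => nomatch f
  RelMap := fun r x => match r with
    | SetRel.mem => (x 0 : ZFSet.{u}) ∈ (x 1 : ZFSet.{u})

/-- A `θ`-strongness embedding for `κ`: a fully elementary embedding `j : V → M` into a transitive
class `M` with critical point `κ` and `V_θ ⊆ M`. (The class `M` is then an inner model: it satisfies
ZFC, being elementarily equivalent to `V`, and it contains every ordinal `α`, since `α ≤ j α`.) -/
structure StrongnessEmbedding (κ : Cardinal.{u}) (θ : Ordinal.{u}) where
  /-- The target model. -/
  M : Set ZFSet.{u}
  transitive : ∀ x ∈ M, ∀ y ∈ x, y ∈ M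
  /-- The elementary embedding. -/
  j : setLanguage.ElementaryEmbedding ZFSet.{u} M
  fixes_below : ∀ α : Ordinal.{u}, α < κ.ord → (j α.toZFSet : ZFSet.{u}) = α.toZFSet
  moves : (j κ.ord.toZFSet : ZFSet.{u}) ≠ κ.ord.toZFSet
  vonNeumann_subset : ∀ x ∈ V_ θ, x ∈ M

/-- `κ` is `θ`-strong. -/
def IsStrong (κ : Cardinal.{u}) (θ : Ordinal.{u}) : Prop :=
  Nonempty (StrongnessEmbedding κ θ)

/-- `ℓ` guesses the target `a` via `j`: the function `j(ℓ)` takes the value `a` at `κ`. -/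
def Guesses {κ : Cardinal.{u}} {θ : Ordinal.{u}} (e : StrongnessEmbedding κ θ)
    (ℓ a : ZFSet.{u}) : Prop :=
  ZFSet.pair κ.ord.toZFSet a ∈ (e.j ℓ : ZFSet.{u})

/-- `ℓ : κ → V_κ` is a `θ`-strongness Laver function for `κ`. -/
def IsLaverFunction (κ : Cardinal.{u}) (θ : Ordinal.{u}) (ℓ : ZFSet.{u}) : Prop :=
  ZFSet.IsFunc κ.ord.toZFSet (V_ κ.ord) ℓ ∧
    ∀ a ∈ V_ θ, ∃ e : StrongnessEmbedding κ θ, Guesses e ℓ a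

/-- `⟨ℓ α ; α < lam⟩` is a `θ`-strongness joint Laver sequence for `κ`. Only the values of `ℓ` and
of the sequence of targets `a` at ordinals `α < lam` matter. -/
def IsJointLaverSequence (κ : Cardinal.{u}) (θ lam : Ordinal.{u})
    (ℓ : Ordinal.{u} → ZFSet.{u}) : Prop :=
  (∀ α < lam, IsLaverFunction κ θ (ℓ α)) ∧
    ∀ a : Ordinal.{u} → ZFSet.{u}, (∀ α < lam, a α ∈ V_ θ) →
      ∃ e : StrongnessEmbedding κ θ, ∀ α < lam, Guesses e (ℓ α) (a α)

/-- The system of measures derived from `j` with seeds in `V_θ`, coded as a set of pairs: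
`(a, X)` belongs to it iff `a ∈ V_θ`, `X ⊆ V_κ` and `a ∈ j(X)`, so that its section at `a` is the
measure on `V_κ` derived from the seed `a`. -/
def derivedExtender {κ : Cardinal.{u}} {θ : Ordinal.{u}} (e : StrongnessEmbedding κ θ) :
    ZFSet.{u} :=
  ZFSet.sep (fun z => ∃ a X : ZFSet.{u}, z = ZFSet.pair a X ∧ a ∈ (e.j X : ZFSet.{u}))
    (ZFSet.prod (V_ θ) (ZFSet.powerset (V_ κ.ord)))

/-- `E` is a `(κ, V_θ)`-extender (`θ` a limit ordinal above `κ`): it is derived from a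
`θ`-strongness embedding `j` with `V_θ ⊆ j(V_κ)`. The last clause says that the measure derived
from each seed in `V_θ` does concentrate on `V_κ`. -/
def IsExtender (κ : Cardinal.{u}) (θ : Ordinal.{u}) (E : ZFSet.{u}) : Prop :=
  ∃ e : StrongnessEmbedding κ θ,
    V_ θ ⊆ (e.j (V_ κ.ord) : ZFSet.{u}) ∧ E = derivedExtender e

/-- The relation induced by `R` on representatives `(a, f)`, `(b, g)` of elements of the ultrapower
of `V` by the extender `F`: the set of pairs `(x, y) ∈ V_κ` with `R (f x) (g y)` belongs to the
measure of `F` with seed `(a, b)`. For limit `θ`, all finite sequences of seeds are coded in `V_θ`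
by iterated pairs, so seeds that are single elements of `V_θ` suffice. Only the restrictions of
`f` and `g` to `V_κ` matter. -/
def UltRel (κ : Cardinal.{u}) (F : ZFSet.{u}) (R : ZFSet.{u} → ZFSet.{u} → Prop)
    (a : ZFSet.{u}) (f : ZFSet.{u} → ZFSet.{u}) (b : ZFSet.{u}) (g : ZFSet.{u} → ZFSet.{u}) :
    Prop :=
  ZFSet.pair (ZFSet.pair a b)
    (ZFSet.sep (fun z => ∃ x y : ZFSet.{u}, z = ZFSet.pair x y ∧ R (f x) (g y)) (V_ κ.ord)) ∈ F

/-- `N` is the transitive collapse of the ultrapower of `V` by `F`, where `π a f` is the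
element of `N` represented by the seed `a ∈ V_θ` and the function `f` on `V_κ`. -/
structure IsCollapsedUltrapower (κ : Cardinal.{u}) (θ : Ordinal.{u}) (F : ZFSet.{u})
    (N : Set ZFSet.{u}) (π : ZFSet.{u} → (ZFSet.{u} → ZFSet.{u}) → ZFSet.{u}) : Prop where
  transitive : ∀ x ∈ N, ∀ y ∈ x, y ∈ N
  range_eq : ∀ x, x ∈ N ↔ ∃ a ∈ V_ θ, ∃ f : ZFSet.{u} → ZFSet.{u}, π a f = x
  eq_iff : ∀ a ∈ V_ θ, ∀ b ∈ V_ θ, ∀ f g : ZFSet.{u} → ZFSet.{u},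
    π a f = π b g ↔ UltRel κ F (· = ·) a f b g
  mem_iff : ∀ a ∈ V_ θ, ∀ b ∈ V_ θ, ∀ f g : ZFSet.{u} → ZFSet.{u},
    π a f ∈ π b g ↔ UltRel κ F (· ∈ ·) a f b g

/-- The `θ`-strongness Mitchell order `E ◁ F` on the `(κ, V_θ)`-extenders: `E` is an element of
the transitive collapse of the ultrapower of `V` by `F`. -/
def MitchellOrder (κ : Cardinal.{u}) (θ : Ordinal.{u})
    (E F : {E : ZFSet.{u} // IsExtender κ θ E}) : Prop :=
  ∃ N π, IsCollapsedUltrapower κ θ F.1 N π ∧ E.1 ∈ N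

/-- The `θ`-strongness Mitchell rank of `κ`: the height of the (well-founded) `θ`-strongness
Mitchell order, that is, the supremum of `rank E + 1` over all `(κ, V_θ)`-extenders `E`. -/
def mitchellRank (κ : Cardinal.{u}) (θ : Ordinal.{u})
    [IsWellFounded _ (MitchellOrder κ θ)] : Ordinal.{u + 1} :=
  ⨆ E : {E : ZFSet.{u} // IsExtender κ θ E},
    Order.succ (IsWellFounded.rank (MitchellOrder κ θ) E)

/-- The Mitchell order is well-founded and its height is the largest possible one, `ℶ_θ⁺`. -/
def HasMaximalMitchellRank (κ : Cardinal.{u}) (θ : Ordinal.{u}) : Prop :=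
  ∃ _ : IsWellFounded _ (MitchellOrder κ θ),
    mitchellRank κ θ = Ordinal.lift.{u + 1} (Order.succ (ℶ_ θ)).ord

end StrongLaver

end

noncomputable section

namespace StrongLaver

open FirstOrder FirstOrder.Language

/-! Fix `j` with `V_θ ⊆ j(V_κ)`. The values `j(f)(a)` with `a ∈ V_θ` form a hull closed under Skolem
functions, whose collapse is the ultrapower by the derived extender `F`. So `E ◁ F` iff `E` is the
collapse of a hull element (`mem_collapsedUltrapower_iff`). Extenders are subsets of `V_θ`, which
the collapse fixes, so lying in the hull suffices.

Well-foundedness: an extender `E` gets an ordinal height, the rank of its ultrapower's comparison of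
functions into codes for ordinals, namely well-founded relations on `V_κ` with a point. It plays the
role of `j_E(κ⁺)`. If `E ◁ F`, the ultrapower by `F` sees this comparison as a relation on `j(V_κ)`
and ranks it by its own codes, so the height strictly increases (`height_lt_height`).

Upper bound: a set below `F` is represented by a seed and a function from `V_κ` to its power set,
hence by an element of `V_θ`. So `F` has at most `ℶ_θ` predecessors, and ranks stay below the
regular cardinal `ℶ_θ⁺`.

Lower bound: cut `A ⊆ V_θ` along a cofinal sequence of length `cf(θ)` and let the joint Laver
sequence guess all the pieces at `κ`. Since `cf(θ) ≤ κ`, the hull recovers `A` from `j` of the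
sequence and from `κ` (`exists_mem_hull`). One such `A` codes `ℶ_θ` many extenders, so any family of
that size has a common `◁`-upper bound, and induction reaches every rank below `ℶ_θ⁺`. -/

/-- The membership symbol of the language of set theory. -/
def memSymbol : setLanguage.Relations 2 := SetRel.mem

/-! ### Bounded formulas and absoluteness -/

/-- A predicate on assignments of sets to variables is *absolute* if a single formula expresses it
in every transitive class. -/
class Absolute (P : (ℕ → ZFSet.{u}) → Prop) : Prop where
  out : ∃ φ : setLanguage.Formula ℕ, ∀ M : Set ZFSet.{u}, (∀ x ∈ M, ∀ y ∈ x, y ∈ M) →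
    ∀ v : ℕ → M, φ.Realize v ↔ P fun i => v i

namespace Absolute

variable {P Q : (ℕ → ZFSet.{u}) → Prop}

instance mem (i k : ℕ) : Absolute fun v : ℕ → ZFSet.{u} => v i ∈ v k := by
  refine ⟨⟨memSymbol.formula₂ (Term.var i) (Term.var k), ?_⟩⟩
  intro M _ v
  rw [Formula.realize_rel₂]
  rfl

instance eq (i k : ℕ) : Absolute fun v : ℕ → ZFSet.{u} => v i = v k := by
  refine ⟨⟨Term.equal (Term.var i) (Term.var k), ?_⟩⟩
  intro M _ v
  rw [Formula.realize_equal]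
  exact Subtype.ext_iff

instance not [hP : Absolute P] : Absolute fun v => ¬ P v := by
  obtain ⟨φ, hφ⟩ := hP
  refine ⟨⟨φ.not, fun M hM v => ?_⟩⟩
  rw [Formula.realize_not, hφ M hM v]

instance imp [hP : Absolute P] [hQ : Absolute Q] : Absolute fun v => P v → Q v := by
  obtain ⟨φ, hφ⟩ := hP
  obtain ⟨ψ, hψ⟩ := hQ
  refine ⟨⟨φ.imp ψ, fun M hM v => ?_⟩⟩
  rw [Formula.realize_imp, hφ M hM v, hψ M hM v]

theorem congr (hP : Absolute P) (h : ∀ v, P v ↔ Q v) : Absolute Q := by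
  have : P = Q := funext fun v => propext (h v)
  exact this ▸ hP

instance and [Absolute P] [Absolute Q] : Absolute fun v => P v ∧ Q v :=
  congr (P := fun v => ¬ (P v → ¬ Q v)) inferInstance fun v => by tauto

instance or [Absolute P] [Absolute Q] : Absolute fun v => P v ∨ Q v :=
  congr (P := fun v => ¬ P v → Q v) inferInstance fun v => by tauto

instance iff [Absolute P] [Absolute Q] : Absolute fun v => P v ↔ Q v :=
  congr (P := fun v => (P v → Q v) ∧ (Q v → P v)) inferInstance fun v => by tauto

theorem rename (hP : Absolute P) (s : ℕ → ℕ) : Absolute fun v => P fun i => v (s i) := by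
  obtain ⟨φ, hφ⟩ := hP
  refine ⟨⟨φ.relabel s, fun M hM v => ?_⟩⟩
  rw [Formula.realize_relabel, hφ M hM]
  rfl

/-- Transitivity puts the witness of a bounded quantifier into the class. As with de Bruijn indices,
the bound variable is 0 and the parameters shift by one. -/
instance bex (i : ℕ) {R : (ℕ → ZFSet.{u}) → ZFSet.{u} → Prop}
    [hR : Absolute fun v => R (fun n => v (n + 1)) (v 0)] :
    Absolute fun v => ∃ x ∈ v i, R v x := by
  have h : Absolute fun v : ℕ → ZFSet.{u} => v 0 ∈ v (i + 1) ∧ R (fun n => v (n + 1)) (v 0) :=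
    inferInstance
  obtain ⟨φ, hφ⟩ := h
  let g : ℕ → ℕ ⊕ Fin 1 := fun n => Nat.casesOn n (Sum.inr 0) Sum.inl
  refine ⟨⟨(BoundedFormula.relabel g φ).ex, fun M hM v => ?_⟩⟩
  rw [Formula.Realize, BoundedFormula.realize_ex]
  have key : ∀ a : M, (BoundedFormula.relabel g φ).Realize v (Fin.snoc default a) ↔
      ((a : ZFSet.{u}) ∈ (v i : ZFSet.{u}) ∧ R (fun n => v n) a) := by
    intro a
    rw [BoundedFormula.realize_relabel]
    have := hφ M hM (fun n => Nat.casesOn n a v)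
    refine Iff.trans ?_ this
    rw [Formula.Realize]
    refine iff_of_eq ?_
    congr 1
    · funext n
      cases n <;> rfl
    · exact Subsingleton.elim _ _
  constructor
  · rintro ⟨a, ha⟩
    obtain ⟨h1, h2⟩ := (key a).1 ha
    exact ⟨a, h1, h2⟩
  · rintro ⟨x, hx, hRx⟩
    exact ⟨⟨x, hM _ (v i).2 x hx⟩, (key _).2 ⟨hx, hRx⟩⟩

instance ball (i : ℕ) {R : (ℕ → ZFSet.{u}) → ZFSet.{u} → Prop}
    [Absolute fun v => R (fun n => v (n + 1)) (v 0)] :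
    Absolute fun v => ∀ x ∈ v i, R v x :=
  congr (P := fun v => ¬ ∃ x ∈ v i, ¬ R v x) inferInstance fun v => by push Not; rfl

instance subset (i k : ℕ) : Absolute fun v : ℕ → ZFSet.{u} => v i ⊆ v k :=
  congr (P := fun v => ∀ x ∈ v i, x ∈ v k) inferInstance fun _ => Iff.rfl

instance eq_singleton (i a : ℕ) : Absolute fun v : ℕ → ZFSet.{u} => v i = {v a} :=
  congr (P := fun v => v a ∈ v i ∧ ∀ x ∈ v i, x = v a) inferInstance fun v => by
    constructor
    · rintro ⟨h1, h2⟩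
      ext x
      rw [ZFSet.mem_singleton]
      exact ⟨h2 x, fun h => h ▸ h1⟩
    · rintro h
      rw [h]
      simp

instance eq_doubleton (i a b : ℕ) : Absolute fun v : ℕ → ZFSet.{u} => v i = {v a, v b} :=
  congr (P := fun v => v a ∈ v i ∧ v b ∈ v i ∧ ∀ x ∈ v i, x = v a ∨ x = v b) inferInstance
    fun v => by
    constructor
    · rintro ⟨h1, h2, h3⟩
      ext x
      rw [ZFSet.mem_pair]
      exact ⟨h3 x, fun h => h.elim (fun h => h ▸ h1) (fun h => h ▸ h2)⟩
    · rintro h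
      rw [h]
      simp

instance eq_pair (i a b : ℕ) : Absolute fun v : ℕ → ZFSet.{u} => v i = ZFSet.pair (v a) (v b) :=
  congr (P := fun v => ∃ s ∈ v i, ∃ t ∈ v i, s = {v a} ∧ t = {v a, v b} ∧
    ∀ x ∈ v i, x = s ∨ x = t) inferInstance
    fun v => by
    constructor
    · rintro ⟨_, h1, _, h2, rfl, rfl, h3⟩
      ext x
      rw [ZFSet.pair, ZFSet.mem_pair]
      exact ⟨h3 x, fun h => h.elim (fun h => h ▸ h1) (fun h => h ▸ h2)⟩
    · rintro h
      rw [h]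
      simp [ZFSet.pair]

instance pair_mem (i a b : ℕ) : Absolute fun v : ℕ → ZFSet.{u} => ZFSet.pair (v a) (v b) ∈ v i :=
  congr (P := fun v => ∃ z ∈ v i, z = ZFSet.pair (v a) (v b)) inferInstance fun v => by simp

/-- Both components lie two membership steps below the pair. The four bounded quantifiers over `s`,
`x`, `t`, `y` cause the shift by four and leave `x` at index 2 and `y` at index 0. -/
instance ex_pair (i : ℕ) {R : (ℕ → ZFSet.{u}) → ZFSet.{u} → ZFSet.{u} → Prop}
    [Absolute fun v => R (fun n => v (n + 1 + 1 + 1 + 1)) (v 2) (v 0)] :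
    Absolute fun v => ∃ x y, v i = ZFSet.pair x y ∧ R v x y :=
  congr (P := fun v => ∃ s ∈ v i, ∃ x ∈ s, ∃ t ∈ v i, ∃ y ∈ t, v i = ZFSet.pair x y ∧ R v x y)
    inferInstance
    fun v => by
    constructor
    · rintro ⟨s, -, x, -, t, -, y, -, h⟩
      exact ⟨x, y, h⟩
    · rintro ⟨x, y, h, h'⟩
      exact ⟨{x}, by simp [h, ZFSet.pair], x, by simp, {x, y}, by simp [h, ZFSet.pair], y, by simp,
        h, h'⟩

instance eq_empty (i : ℕ) : Absolute fun v : ℕ → ZFSet.{u} => v i = ∅ :=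
  congr (P := fun v => ∀ x ∈ v i, x ∉ v i) inferInstance fun v => by
    rw [ZFSet.eq_empty]
    exact ⟨fun h x hx => h x hx hx, fun h x hx => absurd hx (h x)⟩

theorem rename₈ {P : ZFSet.{u} → ZFSet.{u} → ZFSet.{u} → ZFSet.{u} → ZFSet.{u} → ZFSet.{u} →
      ZFSet.{u} → ZFSet.{u} → Prop}
    (hP : Absolute fun v => P (v 0) (v 1) (v 2) (v 3) (v 4) (v 5) (v 6) (v 7))
    (i₀ i₁ i₂ i₃ i₄ i₅ i₆ i₇ : ℕ) :
    Absolute fun v => P (v i₀) (v i₁) (v i₂) (v i₃) (v i₄) (v i₅) (v i₆) (v i₇) :=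
  hP.rename fun n => [i₀, i₁, i₂, i₃, i₄, i₅, i₆, i₇].getD n 0

instance eq_insert_self (i k : ℕ) :
    Absolute fun v : ℕ → ZFSet.{u} => v i = insert (v k) (v k) :=
  congr (P := fun v => v k ∈ v i ∧ (∀ x ∈ v k, x ∈ v i) ∧ ∀ x ∈ v i, x = v k ∨ x ∈ v k)
    inferInstance fun v => by
    constructor
    · rintro ⟨h1, h2, h3⟩
      ext x
      rw [ZFSet.mem_insert_iff]
      exact ⟨h3 x, fun h => h.elim (fun h => h ▸ h1) (h2 x)⟩
    · rintro h
      rw [h]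
      simp +contextual

end Absolute

/-! ### Elementarity, pairs and graphs -/

namespace StrongnessEmbedding

variable {κ : Cardinal.{u}} {θ : Ordinal.{u}} (e : StrongnessEmbedding κ θ)

/-- The image of a set under a strongness embedding, as a set. -/
def app (x : ZFSet.{u}) : ZFSet.{u} := e.j x

/-- One formula expresses `P` both in `M` and in the class of all sets, and `j` preserves it. All
later uses of elementarity pass through this lemma. -/
theorem app_iff {P : (ℕ → ZFSet.{u}) → Prop} (hP : Absolute P) (v : ℕ → ZFSet.{u}) :
    P (fun i => e.app (v i)) ↔ P v := by
  obtain ⟨φ, hφ⟩ := hP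
  have h1 := hφ e.M e.transitive (e.j ∘ v)
  have h2 := e.j.map_formula φ v
  let ι : setLanguage.ElementaryEmbedding ZFSet.{u} (Set.univ : Set ZFSet.{u}) :=
    FirstOrder.Language.Equiv.toElementaryEmbedding
      { (Equiv.Set.univ ZFSet.{u}).symm with
        map_fun' := fun f => nomatch f
        map_rel' := fun {n} (r : SetRel n) x => match n, r, x with
          | _, SetRel.mem, _ => Iff.rfl }
  have h3 := hφ Set.univ (fun _ _ _ _ => trivial) (ι ∘ v)
  have h4 := ι.map_formula φ v
  exact h1.symm.trans (h2.trans (h4.symm.trans h3))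

theorem app_mem_app {x y : ZFSet.{u}} : e.app x ∈ e.app y ↔ x ∈ y :=
  e.app_iff (P := fun v => v 0 ∈ v 1) inferInstance fun n => [x, y].getD n ∅

theorem app_pair (x y : ZFSet.{u}) : e.app (ZFSet.pair x y) = ZFSet.pair (e.app x) (e.app y) :=
  (e.app_iff (P := fun v => v 0 = ZFSet.pair (v 1) (v 2)) inferInstance
    fun n => [ZFSet.pair x y, x, y].getD n ∅).2 rfl

theorem app_empty : e.app ∅ = ∅ :=
  (e.app_iff (P := fun v => v 0 = ∅) inferInstance fun n => [∅].getD n ∅).2 rfl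

theorem isTransitive_app {x : ZFSet.{u}} (hx : x.IsTransitive) : (e.app x).IsTransitive :=
  (e.app_iff (P := fun v => ∀ y ∈ v 0, y ⊆ v 0) inferInstance fun n => [x].getD n ∅).2 hx

end StrongnessEmbedding

theorem pair_mem_vonNeumann {o : Ordinal.{u}} (ho : Order.IsSuccLimit o) {x y : ZFSet.{u}}
    (hx : x ∈ V_ o) (hy : y ∈ V_ o) : ZFSet.pair x y ∈ V_ o := by
  rw [ZFSet.mem_vonNeumann] at *
  rw [ZFSet.pair, ZFSet.rank_pair, ZFSet.rank_pair, ZFSet.rank_singleton]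
  have h1 := ho.succ_lt hx
  have h2 := ho.succ_lt hy
  exact max_lt (ho.succ_lt h1) (ho.succ_lt (max_lt h1 h2))

theorem mem_of_pair_mem {x y T : ZFSet.{u}} (hT : T.IsTransitive) (h : ZFSet.pair x y ∈ T) :
    x ∈ T ∧ y ∈ T := by
  have h1 : ({x, y} : ZFSet.{u}) ∈ T := hT _ h (by simp [ZFSet.pair])
  exact ⟨hT _ h1 (by simp), hT _ h1 (by simp)⟩

/-- The graph of the restriction of `f` to the set `K`. -/
def graphOn (K : ZFSet.{u}) (f : ZFSet.{u} → ZFSet.{u}) : ZFSet.{u} :=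
  ZFSet.range fun x : K => ZFSet.pair x (f x)

theorem mem_graphOn {K z : ZFSet.{u}} {f : ZFSet.{u} → ZFSet.{u}} :
    z ∈ graphOn K f ↔ ∃ x ∈ K, ZFSet.pair x (f x) = z := by
  simp [graphOn]

theorem pair_mem_graphOn {K x y : ZFSet.{u}} {f : ZFSet.{u} → ZFSet.{u}} :
    ZFSet.pair x y ∈ graphOn K f ↔ x ∈ K ∧ f x = y := by
  rw [mem_graphOn]
  constructor
  · rintro ⟨x', hx', h⟩
    obtain ⟨rfl, rfl⟩ := ZFSet.pair_inj.1 h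
    exact ⟨hx', rfl⟩
  · rintro ⟨hx, rfl⟩
    exact ⟨x, hx, rfl⟩

/-- The first component of an ordered pair. -/
def fst (z : ZFSet.{u}) : ZFSet.{u} := Classical.epsilon fun x => ∃ y, z = ZFSet.pair x y

/-- The second component of an ordered pair. -/
def snd (z : ZFSet.{u}) : ZFSet.{u} := Classical.epsilon fun y => ∃ x, z = ZFSet.pair x y

@[simp]
theorem fst_pair (x y : ZFSet.{u}) : fst (ZFSet.pair x y) = x := by
  obtain ⟨y', h⟩ := Classical.epsilon_spec
    (p := fun x' => ∃ y', ZFSet.pair x y = ZFSet.pair x' y') ⟨x, y, rfl⟩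
  exact (ZFSet.pair_inj.1 h).1.symm

@[simp]
theorem snd_pair (x y : ZFSet.{u}) : snd (ZFSet.pair x y) = y := by
  obtain ⟨x', h⟩ := Classical.epsilon_spec
    (p := fun y' => ∃ x', ZFSet.pair x y = ZFSet.pair x' y') ⟨y, x, rfl⟩
  exact (ZFSet.pair_inj.1 h).2.symm

/-! ### The critical point, and the values `j(f)(a)` -/

namespace StrongnessEmbedding

variable {κ : Cardinal.{u}} {θ : Ordinal.{u}} (e : StrongnessEmbedding κ θ)

include e in
theorem isSuccLimit_ord : Order.IsSuccLimit κ.ord := by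
  rcases Ordinal.zero_or_succ_or_isSuccLimit κ.ord with h | ⟨a, h⟩ | h
  · refine absurd ?_ e.moves
    rw [h, Ordinal.toZFSet_zero]
    exact e.app_empty
  · refine absurd ?_ e.moves
    have ha : e.app a.toZFSet = a.toZFSet := e.fixes_below a (by rw [← h]; exact Order.lt_succ a)
    have := (e.app_iff (P := fun v => v 0 = insert (v 1) (v 1)) inferInstance
      fun n => [insert a.toZFSet a.toZFSet, a.toZFSet].getD n ∅).2 rfl
    rw [← h, Order.succ_eq_add_one, Ordinal.toZFSet_add_one]
    refine Eq.trans this ?_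
    simp only [List.getD_cons_succ, List.getD_cons_zero, ha]
  · exact h

-- If `κ = ω`, every element of `j(ω)` is empty or the successor of an element of `j(ω)`; by
-- ∈-induction `j(ω) ⊆ ω`, so `κ` would not move.
include e in
theorem omega0_lt_ord : Ordinal.omega0 < κ.ord := by
  refine lt_of_le_of_ne (Ordinal.omega0_le_of_isSuccLimit e.isSuccLimit_ord) fun hω => e.moves ?_
  rw [← hω]
  have h1 : ∀ z ∈ (Ordinal.omega0.{u}).toZFSet, z = ∅ ∨
      ∃ y ∈ (Ordinal.omega0.{u}).toZFSet, z = insert y y := by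
    intro z hz
    obtain ⟨a, ha, rfl⟩ := Ordinal.mem_toZFSet_iff.1 hz
    obtain ⟨n, rfl⟩ := Ordinal.lt_omega0.1 ha
    cases n with
    | zero => left; simp
    | succ n =>
      refine Or.inr ⟨(n : Ordinal.{u}).toZFSet, ?_, ?_⟩
      · simp
      · rw [← Ordinal.toZFSet_add_one]; simp
  have h2 := (e.app_iff (P := fun v => ∀ z ∈ v 0, z = ∅ ∨ ∃ y ∈ v 0, z = insert y y) inferInstance
    fun n => [(Ordinal.omega0.{u}).toZFSet].getD n ∅).2 h1
  apply ZFSet.ext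
  intro z
  constructor
  · induction z using ZFSet.inductionOn with
    | h z ih =>
      intro hz
      rcases h2 z hz with rfl | ⟨y, hy, rfl⟩
      · rw [← Ordinal.toZFSet_zero, Ordinal.toZFSet_mem_toZFSet_iff]
        exact Ordinal.omega0_pos
      · obtain ⟨a, ha, rfl⟩ := Ordinal.mem_toZFSet_iff.1 (ih y (by simp) hy)
        rw [← Ordinal.toZFSet_add_one, Ordinal.toZFSet_mem_toZFSet_iff]
        exact Ordinal.isSuccLimit_omega0.add_one_lt ha
  · intro hz
    obtain ⟨a, ha, rfl⟩ := Ordinal.mem_toZFSet_iff.1 hz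
    have := e.app_mem_app.2 hz
    have h3 : e.app a.toZFSet = a.toZFSet := e.fixes_below a (hω ▸ ha)
    rwa [h3] at this

/-- The value at `a` of the image under the embedding of the function `f` on `V_κ`. -/
def value (f : ZFSet.{u} → ZFSet.{u}) (a : ZFSet.{u}) : ZFSet.{u} :=
  Classical.epsilon fun y => ZFSet.pair a y ∈ e.app (graphOn (V_ κ.ord) f)

theorem pair_value_mem (f : ZFSet.{u} → ZFSet.{u}) {a : ZFSet.{u}} (ha : a ∈ e.app (V_ κ.ord)) :
    ZFSet.pair a (e.value f a) ∈ e.app (graphOn (V_ κ.ord) f) := by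
  have h := (e.app_iff (P := fun v => ∀ x ∈ v 0, ∃ z ∈ v 1, ∃ x' y, z = ZFSet.pair x' y ∧ x' = x)
    inferInstance fun n => [V_ κ.ord, graphOn (V_ κ.ord) f].getD n ∅).2
    fun x hx => ⟨ZFSet.pair x (f x), mem_graphOn.2 ⟨x, hx, rfl⟩, x, f x, rfl, rfl⟩
  obtain ⟨z, hz, x, y, rfl, rfl⟩ := h a ha
  exact Classical.epsilon_spec (p := fun y => ZFSet.pair x y ∈ e.app (graphOn (V_ κ.ord) f)) ⟨y, hz⟩

theorem eq_value {f : ZFSet.{u} → ZFSet.{u}} {a y : ZFSet.{u}} (ha : a ∈ e.app (V_ κ.ord))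
    (h : ZFSet.pair a y ∈ e.app (graphOn (V_ κ.ord) f)) : y = e.value f a := by
  have h' := (e.app_iff (P := fun v => ∀ z ∈ v 0, ∀ z' ∈ v 0, ∃ x y, z = ZFSet.pair x y ∧
    ∃ x' y', z' = ZFSet.pair x' y' ∧ (x = x' → y = y'))
    inferInstance fun n => [graphOn (V_ κ.ord) f].getD n ∅).2 (by
      intro z hz z' hz'
      obtain ⟨x, -, rfl⟩ := mem_graphOn.1 hz
      obtain ⟨x', -, rfl⟩ := mem_graphOn.1 hz'
      exact ⟨x, f x, rfl, x', f x', rfl, fun h => by rw [h]⟩)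
  obtain ⟨x, y₁, h1, x', y₂, h2, h3⟩ := h' _ h _ (e.pair_value_mem f ha)
  obtain ⟨rfl, rfl⟩ := ZFSet.pair_inj.1 h1
  obtain ⟨rfl, rfl⟩ := ZFSet.pair_inj.1 h2
  exact h3 rfl

theorem value_id {a : ZFSet.{u}} (ha : a ∈ e.app (V_ κ.ord)) : e.value (fun x => x) a = a := by
  refine (e.eq_value ha ?_).symm
  have h := (e.app_iff (P := fun v => ∀ x ∈ v 0, ZFSet.pair x x ∈ v 1)
    inferInstance fun n => [V_ κ.ord, graphOn (V_ κ.ord) fun x => x].getD n ∅).2 (by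
      intro x hx
      change ZFSet.pair x x ∈ graphOn (V_ κ.ord) fun x => x
      exact pair_mem_graphOn.2 ⟨hx, rfl⟩)
  exact h a ha

theorem value_of_forall_pair_left {f g : ZFSet.{u} → ZFSet.{u}}
    (h : ∀ x ∈ V_ κ.ord, ∀ y ∈ V_ κ.ord, g (ZFSet.pair x y) = f x) {a b : ZFSet.{u}}
    (ha : a ∈ e.app (V_ κ.ord)) (hab : ZFSet.pair a b ∈ e.app (V_ κ.ord)) :
    e.value g (ZFSet.pair a b) = e.value f a := by
  refine e.eq_value ha ?_
  -- The vacuous conjunct `x = x` only gives "is a pair" the shape handled by `ex_pair`.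
  have h' := (e.app_iff (P := fun v => ∀ z ∈ v 0, ∃ p w, z = ZFSet.pair p w ∧
      ((∃ x y, p = ZFSet.pair x y ∧ x = x) → ∃ x y, p = ZFSet.pair x y ∧ ZFSet.pair x w ∈ v 1))
    inferInstance fun n => [graphOn (V_ κ.ord) g, graphOn (V_ κ.ord) f].getD n ∅).2 (by
      intro z hz
      obtain ⟨p, hp, rfl⟩ := mem_graphOn.1 hz
      refine ⟨p, g p, rfl, ?_⟩
      rintro ⟨x, y, rfl, -⟩
      have hxy := mem_of_pair_mem (ZFSet.isTransitive_vonNeumann _) hp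
      exact ⟨x, y, rfl, pair_mem_graphOn.2 ⟨hxy.1, (h x hxy.1 y hxy.2).symm⟩⟩)
  obtain ⟨p, w, h1, h2⟩ := h' _ (e.pair_value_mem g hab)
  obtain ⟨rfl, rfl⟩ := ZFSet.pair_inj.1 h1
  obtain ⟨x, y, h3, h4⟩ := h2 ⟨a, b, rfl, rfl⟩
  obtain ⟨rfl, rfl⟩ := ZFSet.pair_inj.1 h3
  exact h4

theorem value_of_forall_pair_right {f g : ZFSet.{u} → ZFSet.{u}}
    (h : ∀ x ∈ V_ κ.ord, ∀ y ∈ V_ κ.ord, g (ZFSet.pair x y) = f y) {a b : ZFSet.{u}}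
    (hb : b ∈ e.app (V_ κ.ord)) (hab : ZFSet.pair a b ∈ e.app (V_ κ.ord)) :
    e.value g (ZFSet.pair a b) = e.value f b := by
  refine e.eq_value hb ?_
  have h' := (e.app_iff (P := fun v => ∀ z ∈ v 0, ∃ p w, z = ZFSet.pair p w ∧
      ((∃ x y, p = ZFSet.pair x y ∧ x = x) → ∃ x y, p = ZFSet.pair x y ∧ ZFSet.pair y w ∈ v 1))
    inferInstance fun n => [graphOn (V_ κ.ord) g, graphOn (V_ κ.ord) f].getD n ∅).2 (by
      intro z hz
      obtain ⟨p, hp, rfl⟩ := mem_graphOn.1 hz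
      refine ⟨p, g p, rfl, ?_⟩
      rintro ⟨x, y, rfl, -⟩
      have hxy := mem_of_pair_mem (ZFSet.isTransitive_vonNeumann _) hp
      exact ⟨x, y, rfl, pair_mem_graphOn.2 ⟨hxy.2, (h x hxy.1 y hxy.2).symm⟩⟩)
  obtain ⟨p, w, h1, h2⟩ := h' _ (e.pair_value_mem g hab)
  obtain ⟨rfl, rfl⟩ := ZFSet.pair_inj.1 h1
  obtain ⟨x, y, h3, h4⟩ := h2 ⟨a, b, rfl, rfl⟩
  obtain ⟨rfl, rfl⟩ := ZFSet.pair_inj.1 h3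
  exact h4

/-- The working form of Łoś: a bounded statement about function values true throughout `V_κ` holds
for the values at any `a ∈ j(V_κ)`. Three parameters and five functions cover every later use. -/
theorem value_forall {P : ZFSet.{u} → ZFSet.{u} → ZFSet.{u} → ZFSet.{u} → ZFSet.{u} → ZFSet.{u} →
      ZFSet.{u} → ZFSet.{u} → Prop}
    (hP : Absolute fun v => P (v 0) (v 1) (v 2) (v 3) (v 4) (v 5) (v 6) (v 7))
    (s t r : ZFSet.{u}) (f₁ f₂ f₃ f₄ f₅ : ZFSet.{u} → ZFSet.{u})
    (h : ∀ x ∈ V_ κ.ord, P s t r (f₁ x) (f₂ x) (f₃ x) (f₄ x) (f₅ x)) {a : ZFSet.{u}}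
    (ha : a ∈ e.app (V_ κ.ord)) :
    P (e.app s) (e.app t) (e.app r) (e.value f₁ a) (e.value f₂ a) (e.value f₃ a) (e.value f₄ a)
      (e.value f₅ a) := by
  have hP' := hP.rename₈
  have h' := (e.app_iff (P := fun v => ∀ x ∈ v 0,
      ∀ z₁ ∈ v 4, ∃ x₁ y₁, z₁ = ZFSet.pair x₁ y₁ ∧ (x₁ = x →
      ∀ z₂ ∈ v 5, ∃ x₂ y₂, z₂ = ZFSet.pair x₂ y₂ ∧ (x₂ = x →
      ∀ z₃ ∈ v 6, ∃ x₃ y₃, z₃ = ZFSet.pair x₃ y₃ ∧ (x₃ = x →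
      ∀ z₄ ∈ v 7, ∃ x₄ y₄, z₄ = ZFSet.pair x₄ y₄ ∧ (x₄ = x →
      ∀ z₅ ∈ v 8, ∃ x₅ y₅, z₅ = ZFSet.pair x₅ y₅ ∧ (x₅ = x →
      P (v 1) (v 2) (v 3) y₁ y₂ y₃ y₄ y₅))))))
    inferInstance fun n => [V_ κ.ord, s, t, r, graphOn (V_ κ.ord) f₁, graphOn (V_ κ.ord) f₂,
      graphOn (V_ κ.ord) f₃, graphOn (V_ κ.ord) f₄, graphOn (V_ κ.ord) f₅].getD n ∅).2 (by
      intro x hx z₁ h₁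
      obtain ⟨x₁, -, rfl⟩ := mem_graphOn.1 h₁
      refine ⟨_, _, rfl, ?_⟩
      rintro rfl z₂ h₂
      obtain ⟨x₂, -, rfl⟩ := mem_graphOn.1 h₂
      refine ⟨_, _, rfl, ?_⟩
      rintro rfl z₃ h₃
      obtain ⟨x₃, -, rfl⟩ := mem_graphOn.1 h₃
      refine ⟨_, _, rfl, ?_⟩
      rintro rfl z₄ h₄
      obtain ⟨x₄, -, rfl⟩ := mem_graphOn.1 h₄
      refine ⟨_, _, rfl, ?_⟩
      rintro rfl z₅ h₅
      obtain ⟨x₅, -, rfl⟩ := mem_graphOn.1 h₅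
      refine ⟨_, _, rfl, ?_⟩
      rintro rfl
      exact h _ hx)
  obtain ⟨_, _, q₁, h₁⟩ := h' a ha _ (e.pair_value_mem f₁ ha)
  obtain ⟨rfl, rfl⟩ := ZFSet.pair_inj.1 q₁
  obtain ⟨_, _, q₂, h₂⟩ := h₁ rfl _ (e.pair_value_mem f₂ ha)
  obtain ⟨rfl, rfl⟩ := ZFSet.pair_inj.1 q₂
  obtain ⟨_, _, q₃, h₃⟩ := h₂ rfl _ (e.pair_value_mem f₃ ha)
  obtain ⟨rfl, rfl⟩ := ZFSet.pair_inj.1 q₃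
  obtain ⟨_, _, q₄, h₄⟩ := h₃ rfl _ (e.pair_value_mem f₄ ha)
  obtain ⟨rfl, rfl⟩ := ZFSet.pair_inj.1 q₄
  obtain ⟨_, _, q₅, h₅⟩ := h₄ rfl _ (e.pair_value_mem f₅ ha)
  obtain ⟨rfl, rfl⟩ := ZFSet.pair_inj.1 q₅
  exact h₅ rfl

end StrongnessEmbedding

/-! ### The seed hull and its collapse: the extender ultrapower -/

section Mostowski

variable {r : ZFSet.{u} → ZFSet.{u} → Prop} (hr : WellFounded r)
  [∀ x, Small.{u} {y // r y x}]

/-- The Mostowski collapse of a well-founded set-like relation. -/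
def mostowski : ZFSet.{u} → ZFSet.{u} :=
  hr.fix fun x ih => ZFSet.range fun y : {y // r y x} => ih y y.2

theorem mem_mostowski {x z : ZFSet.{u}} :
    z ∈ mostowski hr x ↔ ∃ y, r y x ∧ mostowski hr y = z := by
  rw [mostowski, hr.fix_eq, ZFSet.mem_range]
  simp

end Mostowski

namespace StrongnessEmbedding

variable {κ : Cardinal.{u}} {θ : Ordinal.{u}} (e : StrongnessEmbedding κ θ)

/-- The seed hull of an embedding: the class of all `j(f)(a)` with `a ∈ V_θ`. -/
def hull : Set ZFSet.{u} := {x | ∃ a ∈ V_ θ, ∃ f : ZFSet.{u} → ZFSet.{u}, e.value f a = x}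

instance (x : ZFSet.{u}) : Small.{u} {y // y ∈ x ∧ y ∈ e.hull} :=
  small_of_injective (β := x) (f := fun y => ⟨y.1, y.2.1⟩) fun y z h => by
    simpa [Subtype.ext_iff] using h

theorem wellFounded_mem_hull : WellFounded fun y x : ZFSet.{u} => y ∈ x ∧ y ∈ e.hull :=
  Subrelation.wf (fun h => h.1) ZFSet.mem_wf

/-- The transitive collapse of the seed hull. -/
def collapse : ZFSet.{u} → ZFSet.{u} := mostowski e.wellFounded_mem_hull

theorem mem_collapse {x z : ZFSet.{u}} :
    z ∈ e.collapse x ↔ ∃ y ∈ e.hull, y ∈ x ∧ e.collapse y = z := by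
  rw [collapse, mem_mostowski]
  constructor
  · rintro ⟨y, ⟨h1, h2⟩, h3⟩
    exact ⟨y, h2, h1, h3⟩
  · rintro ⟨y, h2, h1, h3⟩
    exact ⟨y, ⟨h1, h2⟩, h3⟩

/-- The seeds in `V_θ` concentrate on `V_κ`, and `θ` is a limit ordinal. -/
structure IsSeeded : Prop where
  isSuccLimit : Order.IsSuccLimit θ
  subset : V_ θ ⊆ e.app (V_ κ.ord)

variable {e}

theorem value_mem_hull {a : ZFSet.{u}} (ha : a ∈ V_ θ) (f : ZFSet.{u} → ZFSet.{u}) :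
    e.value f a ∈ e.hull :=
  ⟨a, ha, f, rfl⟩

namespace IsSeeded

variable (he : e.IsSeeded)
include he

theorem pair_mem {a b : ZFSet.{u}} (ha : a ∈ V_ θ) (hb : b ∈ V_ θ) : ZFSet.pair a b ∈ V_ θ :=
  pair_mem_vonNeumann he.isSuccLimit ha hb

theorem mem_hull {a : ZFSet.{u}} (ha : a ∈ V_ θ) : a ∈ e.hull :=
  ⟨a, ha, fun x => x, e.value_id (he.subset ha)⟩

theorem empty_mem : ∅ ∈ V_ θ := by
  rw [ZFSet.mem_vonNeumann, ZFSet.rank_empty]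
  exact he.isSuccLimit.bot_lt

theorem value_fst {a b : ZFSet.{u}} (ha : a ∈ V_ θ) (hb : b ∈ V_ θ) (f : ZFSet.{u} → ZFSet.{u}) :
    e.value (fun z => f (fst z)) (ZFSet.pair a b) = e.value f a :=
  e.value_of_forall_pair_left (fun x _ y _ => by simp) (he.subset ha)
    (he.subset (he.pair_mem ha hb))

theorem value_snd {a b : ZFSet.{u}} (ha : a ∈ V_ θ) (hb : b ∈ V_ θ) (f : ZFSet.{u} → ZFSet.{u}) :
    e.value (fun z => f (snd z)) (ZFSet.pair a b) = e.value f b :=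
  e.value_of_forall_pair_right (fun x _ y _ => by simp) (he.subset hb)
    (he.subset (he.pair_mem ha hb))

theorem exists_common_seed {x y : ZFSet.{u}} (hx : x ∈ e.hull) (hy : y ∈ e.hull) :
    ∃ a ∈ V_ θ, ∃ f g : ZFSet.{u} → ZFSet.{u}, e.value f a = x ∧ e.value g a = y := by
  obtain ⟨a, ha, f, rfl⟩ := hx
  obtain ⟨b, hb, g, rfl⟩ := hy
  exact ⟨_, he.pair_mem ha hb, _, _, he.value_fst ha hb f, he.value_snd ha hb g⟩

/-- The hull is closed under Skolem functions chosen in `V`: the four arguments get one common seed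
by pairing, and the Skolem function is composed with their representing functions. -/
theorem hull_exists {P : ZFSet.{u} → ZFSet.{u} → ZFSet.{u} → ZFSet.{u} → ZFSet.{u} → ZFSet.{u} →
      ZFSet.{u} → ZFSet.{u} → Prop}
    (hP : Absolute fun v => P (v 0) (v 1) (v 2) (v 3) (v 4) (v 5) (v 6) (v 7))
    {s t r : ZFSet.{u}} (h : ∀ u₁ u₂ u₃ u₄, ∃ w, P s t r u₁ u₂ u₃ u₄ w) {x₁ x₂ x₃ x₄ : ZFSet.{u}}
    (h₁ : x₁ ∈ e.hull) (h₂ : x₂ ∈ e.hull) (h₃ : x₃ ∈ e.hull) (h₄ : x₄ ∈ e.hull) :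
    ∃ w ∈ e.hull, P (e.app s) (e.app t) (e.app r) x₁ x₂ x₃ x₄ w := by
  obtain ⟨a, ha, f₁, f₂, rfl, rfl⟩ := he.exists_common_seed h₁ h₂
  obtain ⟨b, hb, f₃, f₄, rfl, rfl⟩ := he.exists_common_seed h₃ h₄
  choose F hF using h
  have hab := he.pair_mem ha hb
  refine ⟨_, value_mem_hull hab fun z => F (f₁ (fst z)) (f₂ (fst z)) (f₃ (snd z)) (f₄ (snd z)),
    ?_⟩
  rw [← he.value_fst ha hb f₁, ← he.value_fst ha hb f₂, ← he.value_snd ha hb f₃,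
    ← he.value_snd ha hb f₄]
  exact e.value_forall hP s t r _ _ _ _ _ (fun x _ => hF _ _ _ _) (he.subset hab)

/-- Łoś for a binary relation: `j` of the set `S` of pairs in `V_κ` satisfying the relation contains
`(a, b)` exactly when the two values are related. -/
theorem ultRel_iff {R : ZFSet.{u} → ZFSet.{u} → ZFSet.{u} → Prop}
    (hR : Absolute fun v => R (v 0) (v 1) (v 2)) (s : ZFSet.{u}) {a b : ZFSet.{u}}
    (ha : a ∈ V_ θ) (hb : b ∈ V_ θ) (f g : ZFSet.{u} → ZFSet.{u}) :
    UltRel κ (derivedExtender e) (R s) a f b g ↔ R (e.app s) (e.value f a) (e.value g b) := by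
  have hab := he.pair_mem ha hb
  have hR' : ∀ i k l, Absolute fun v => R (v i) (v k) (v l) := fun i k l =>
    hR.rename fun n => [i, k, l].getD n 0
  set S : ZFSet.{u} := ZFSet.sep (fun z => ∃ x y : ZFSet.{u}, z = ZFSet.pair x y ∧
    R s (f x) (g y)) (V_ κ.ord) with hS
  have key : ZFSet.pair a b ∈ e.app S ↔ R (e.app s) (e.value f a) (e.value g b) := by
    have h := e.value_forall (P := fun S s _ z p q _ _ =>
      (∃ x y, z = ZFSet.pair x y ∧ x = x) → (z ∈ S ↔ R s p q)) inferInstance S s ∅ (fun z => z)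
      (fun z => f (fst z)) (fun z => g (snd z)) (fun z => z) (fun z => z) (by
        rintro z hz ⟨x, y, rfl, -⟩
        rw [hS, ZFSet.mem_sep, fst_pair, snd_pair]
        constructor
        · rintro ⟨-, x', y', h1, h2⟩
          obtain ⟨rfl, rfl⟩ := ZFSet.pair_inj.1 h1
          exact h2
        · exact fun h => ⟨hz, x, y, rfl, h⟩) (he.subset hab)
    rw [e.value_id (he.subset hab), he.value_fst ha hb, he.value_snd ha hb] at h
    exact h ⟨a, b, rfl, rfl⟩
  rw [UltRel, ← hS, derivedExtender, ZFSet.mem_sep, ← key]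
  constructor
  · rintro ⟨-, a', X, h1, h2⟩
    obtain ⟨rfl, rfl⟩ := ZFSet.pair_inj.1 h1
    exact h2
  · intro h
    refine ⟨ZFSet.pair_mem_prod.2 ⟨hab, ?_⟩, _, _, rfl, h⟩
    rw [ZFSet.mem_powerset]
    exact ZFSet.sep_subset

theorem exists_mem_hull_of_ne {x y : ZFSet.{u}} (hx : x ∈ e.hull) (hy : y ∈ e.hull) (h : x ≠ y) :
    ∃ w ∈ e.hull, (w ∈ x ∧ w ∉ y) ∨ (w ∈ y ∧ w ∉ x) := by
  obtain ⟨w, hw, h'⟩ := he.hull_exists (P := fun _ _ _ x y _ _ w =>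
    x ≠ y → (w ∈ x ∧ w ∉ y) ∨ (w ∈ y ∧ w ∉ x)) inferInstance (s := ∅) (t := ∅) (r := ∅) (by
      intro x y _ _
      by_cases hxy : x = y
      · exact ⟨∅, fun h => absurd hxy h⟩
      · by_contra hcon
        push Not at hcon
        refine hxy (ZFSet.ext fun z => ?_)
        have := (hcon z).2
        tauto) hx hy hx hx
  exact ⟨w, hw, h' h⟩

/-- The hull is extensional: two distinct hull elements are separated by a hull element
(`exists_mem_hull_of_ne`). -/
theorem collapse_injOn : Set.InjOn e.collapse e.hull := by
  intro x
  induction x using ZFSet.inductionOn with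
  | h x ih =>
    intro hx y hy hxy
    by_contra hne
    obtain ⟨w, hw, ⟨h1, h2⟩ | ⟨h1, h2⟩⟩ := he.exists_mem_hull_of_ne hx hy hne
    · have h3 : e.collapse w ∈ e.collapse y := hxy ▸ e.mem_collapse.2 ⟨w, hw, h1, rfl⟩
      obtain ⟨w', hw', h4, h5⟩ := e.mem_collapse.1 h3
      exact h2 (ih w h1 hw hw' h5.symm ▸ h4)
    · have h3 : e.collapse w ∈ e.collapse x := hxy ▸ e.mem_collapse.2 ⟨w, hw, h1, rfl⟩
      obtain ⟨w', hw', h4, h5⟩ := e.mem_collapse.1 h3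
      exact h2 (ih w' h4 hw' hw h5 ▸ h4)

theorem collapse_mem_collapse {x y : ZFSet.{u}} (hx : x ∈ e.hull) :
    e.collapse x ∈ e.collapse y ↔ x ∈ y := by
  rw [e.mem_collapse]
  constructor
  · rintro ⟨z, hz, hzy, h⟩
    exact he.collapse_injOn hz hx h ▸ hzy
  · exact fun h => ⟨x, hx, h, rfl⟩

theorem collapse_eq_self_of_subset {A : ZFSet.{u}} (hA : A ⊆ V_ θ) : e.collapse A = A := by
  induction A using ZFSet.inductionOn with
  | h A ih =>
    have ih' : ∀ y ∈ A, e.collapse y = y := fun y hy =>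
      ih y hy ((ZFSet.isTransitive_vonNeumann θ).subset_of_mem (hA hy))
    ext z
    rw [e.mem_collapse]
    constructor
    · rintro ⟨y, -, hy, rfl⟩
      rwa [ih' y hy]
    · exact fun hz => ⟨z, he.mem_hull (hA hz), hz, ih' z hz⟩

theorem collapse_eq_self {a : ZFSet.{u}} (ha : a ∈ V_ θ) : e.collapse a = a :=
  he.collapse_eq_self_of_subset ((ZFSet.isTransitive_vonNeumann θ).subset_of_mem ha)

/-- A hull element `y` may differ from its collapse `E`, having elements outside the hull. On `V_θ`,
which lies in the hull and is fixed by the collapse, the two agree. -/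
theorem mem_iff_mem_of_collapse_eq {y E : ZFSet.{u}} (hyE : e.collapse y = E) {a : ZFSet.{u}}
    (ha : a ∈ V_ θ) : a ∈ E ↔ a ∈ y := by
  subst hyE
  conv_lhs => rw [← he.collapse_eq_self ha]
  exact he.collapse_mem_collapse (he.mem_hull ha)

theorem mem_vonNeumann_of_collapse_eq {y E : ZFSet.{u}} (hyE : e.collapse y = E)
    (hE : E ⊆ V_ θ) {x : ZFSet.{u}} (hx : x ∈ e.hull) (hxy : x ∈ y) : x ∈ V_ θ := by
  have h : e.collapse x ∈ V_ θ := hE (hyE ▸ (he.collapse_mem_collapse hx).2 hxy)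
  have := he.collapse_injOn hx (he.mem_hull h) (he.collapse_eq_self h).symm
  rwa [this]

theorem ultRel_eq_iff {a b : ZFSet.{u}} (ha : a ∈ V_ θ) (hb : b ∈ V_ θ)
    (f g : ZFSet.{u} → ZFSet.{u}) :
    UltRel κ (derivedExtender e) (· = ·) a f b g ↔ e.value f a = e.value g b :=
  he.ultRel_iff (R := fun _ x y => x = y) inferInstance ∅ ha hb f g

theorem ultRel_mem_iff {a b : ZFSet.{u}} (ha : a ∈ V_ θ) (hb : b ∈ V_ θ)
    (f g : ZFSet.{u} → ZFSet.{u}) :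
    UltRel κ (derivedExtender e) (· ∈ ·) a f b g ↔ e.value f a ∈ e.value g b :=
  he.ultRel_iff (R := fun _ x y => x ∈ y) inferInstance ∅ ha hb f g

theorem isCollapsedUltrapower : IsCollapsedUltrapower κ θ (derivedExtender e)
    (e.collapse '' e.hull) fun a f => e.collapse (e.value f a) where
  transitive := by
    rintro _ ⟨x, -, rfl⟩ y hy
    obtain ⟨z, hz, -, rfl⟩ := e.mem_collapse.1 hy
    exact ⟨z, hz, rfl⟩
  range_eq x := by
    constructor
    · rintro ⟨_, ⟨a, ha, f, rfl⟩, rfl⟩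
      exact ⟨a, ha, f, rfl⟩
    · rintro ⟨a, ha, f, rfl⟩
      exact ⟨_, value_mem_hull ha f, rfl⟩
  eq_iff a ha b hb f g := by
    rw [he.ultRel_eq_iff ha hb]
    exact he.collapse_injOn.eq_iff (value_mem_hull ha f) (value_mem_hull hb g)
  mem_iff a ha b hb f g := by
    rw [he.ultRel_mem_iff ha hb]
    exact he.collapse_mem_collapse (value_mem_hull ha f)

/-- Uniqueness of the transitive collapse, by ∈-induction; it allows any `N` and `π` to be replaced
by the collapsed hull. -/
theorem collapse_value_eq {N : Set ZFSet.{u}}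
    {π : ZFSet.{u} → (ZFSet.{u} → ZFSet.{u}) → ZFSet.{u}}
    (h : IsCollapsedUltrapower κ θ (derivedExtender e) N π) {a : ZFSet.{u}} (ha : a ∈ V_ θ)
    (f : ZFSet.{u} → ZFSet.{u}) : e.collapse (e.value f a) = π a f := by
  induction hx : π a f using ZFSet.inductionOn generalizing a f with
  | h x ih =>
    ext z
    rw [e.mem_collapse]
    constructor
    · rintro ⟨_, ⟨b, hb, g, rfl⟩, hy, rfl⟩
      have h1 : π b g ∈ x := by
        rw [← hx, h.mem_iff b hb a ha, he.ultRel_mem_iff hb ha]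
        exact hy
      rwa [ih _ h1 hb g rfl]
    · intro hz
      have hxN : x ∈ N := (h.range_eq x).2 ⟨a, ha, f, hx⟩
      obtain ⟨b, hb, g, rfl⟩ := (h.range_eq z).1 (h.transitive x hxN z hz)
      refine ⟨_, value_mem_hull hb g, ?_, ih _ hz hb g rfl⟩
      rwa [← hx, h.mem_iff b hb a ha, he.ultRel_mem_iff hb ha] at hz

theorem mem_collapsedUltrapower_iff {E : ZFSet.{u}} :
    (∃ N π, IsCollapsedUltrapower κ θ (derivedExtender e) N π ∧ E ∈ N) ↔
      ∃ y ∈ e.hull, e.collapse y = E := by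
  constructor
  · rintro ⟨N, π, h, hE⟩
    obtain ⟨a, ha, f, rfl⟩ := (h.range_eq E).1 hE
    exact ⟨_, value_mem_hull ha f, he.collapse_value_eq h ha f⟩
  · intro h
    exact ⟨_, _, he.isCollapsedUltrapower, h⟩

end IsSeeded

theorem derivedExtender_subset (hθ : Order.IsSuccLimit θ) (hκ : κ.ord < θ) :
    derivedExtender e ⊆ V_ θ := by
  intro z hz
  rw [derivedExtender, ZFSet.mem_sep, ZFSet.mem_prod] at hz
  obtain ⟨⟨a, ha, X, hX, rfl⟩, -⟩ := hz
  refine pair_mem_vonNeumann hθ ha ?_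
  rw [ZFSet.mem_powerset, ZFSet.subset_vonNeumann] at hX
  exact ZFSet.mem_vonNeumann.2 (hX.trans_lt hκ)

end StrongnessEmbedding

/-! ### Ranks, closure of limit levels, and codes for ordinals -/

theorem rank_le_rank_of_map {α : Type u} {r s : α → α → Prop} {φ : α → α}
    (hr : WellFounded r) (hs : WellFounded s) (h : ∀ a b, r a b → s (φ a) (φ b)) (a : α) :
    (hr.apply a).rank ≤ (hs.apply (φ a)).rank := by
  induction a using hr.induction with
  | h a ih =>
    rw [Acc.rank_eq]
    exact Ordinal.iSup_le fun b => Order.succ_le_of_lt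
      ((ih b b.2).trans_lt (Acc.rank_lt_of_rel (hs.apply (φ a)) (h _ _ b.2)))

section Closure

variable {o : Ordinal.{u}} (ho : Order.IsSuccLimit o) {x y : ZFSet.{u}}
include ho

theorem powerset_mem_vonNeumann (hx : x ∈ V_ o) : ZFSet.powerset x ∈ V_ o := by
  rw [ZFSet.mem_vonNeumann, ZFSet.rank_powerset]
  exact ho.succ_lt (ZFSet.mem_vonNeumann.1 hx)

theorem prod_mem_vonNeumann (hx : x ∈ V_ o) (hy : y ∈ V_ o) : ZFSet.prod x y ∈ V_ o := by
  refine ZFSet.mem_vonNeumann_of_subset (y := (ZFSet.powerset (ZFSet.powerset (x ∪ y))))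
    (by unfold ZFSet.prod ZFSet.pairSep; exact ZFSet.sep_subset)
    (powerset_mem_vonNeumann ho (powerset_mem_vonNeumann ho ?_))
  rw [ZFSet.mem_vonNeumann, ZFSet.rank_union]
  exact max_lt (ZFSet.mem_vonNeumann.1 hx) (ZFSet.mem_vonNeumann.1 hy)

theorem funs_mem_vonNeumann (hx : x ∈ V_ o) (hy : y ∈ V_ o) : ZFSet.funs x y ∈ V_ o :=
  ZFSet.mem_vonNeumann_of_subset (y := ZFSet.powerset (ZFSet.prod x y)) ZFSet.sep_subset
    (powerset_mem_vonNeumann ho (prod_mem_vonNeumann ho hx hy))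

end Closure

/-- The value at `x` of a function coded by a set of pairs. -/
def applySet (f x : ZFSet.{u}) : ZFSet.{u} := Classical.epsilon fun y => ZFSet.pair x y ∈ f

theorem pair_applySet_mem {K Y f : ZFSet.{u}} (hf : ZFSet.IsFunc K Y f) {x : ZFSet.{u}}
    (hx : x ∈ K) : ZFSet.pair x (applySet f x) ∈ f :=
  Classical.epsilon_spec (p := fun y => ZFSet.pair x y ∈ f) (hf.2 x hx).exists

theorem applySet_mem {K Y f : ZFSet.{u}} (hf : ZFSet.IsFunc K Y f) {x : ZFSet.{u}}
    (hx : x ∈ K) : applySet f x ∈ Y :=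
  (ZFSet.pair_mem_prod.1 (hf.1 (pair_applySet_mem hf hx))).2

theorem graphOn_applySet {K Y f : ZFSet.{u}} (hf : ZFSet.IsFunc K Y f) :
    graphOn K (applySet f) = f := by
  ext z
  rw [mem_graphOn]
  constructor
  · rintro ⟨x, hx, rfl⟩
    exact pair_applySet_mem hf hx
  · intro hz
    obtain ⟨x, hx, y, -, rfl⟩ := ZFSet.mem_prod.1 (hf.1 hz)
    exact ⟨x, hx, by rw [(hf.2 x hx).unique (pair_applySet_mem hf hx) hz]⟩

theorem isFunc_graphOn {K Y : ZFSet.{u}} {f : ZFSet.{u} → ZFSet.{u}} (hf : ∀ x ∈ K, f x ∈ Y) :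
    ZFSet.IsFunc K Y (graphOn K f) := by
  refine ⟨fun z hz => ?_, fun x hx => ⟨f x, pair_mem_graphOn.2 ⟨hx, rfl⟩, fun y hy => ?_⟩⟩
  · obtain ⟨x, hx, rfl⟩ := mem_graphOn.1 hz
    exact ZFSet.pair_mem_prod.2 ⟨hx, hf x hx⟩
  · exact (pair_mem_graphOn.1 hy).2.symm

/-- The binary relation coded by a set of pairs. -/
def relOf (W : ZFSet.{u}) (p q : ZFSet.{u}) : Prop := ZFSet.pair p q ∈ W

/-- The set of pairs `(W, p)` of a well-founded relation `W` on `K` and a point `p` of `K`. -/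
def rankCodes (K : ZFSet.{u}) : ZFSet.{u} :=
  ZFSet.sep (fun d => WellFounded (relOf (fst d)))
    (ZFSet.prod (ZFSet.powerset (ZFSet.prod K K)) K)

theorem pair_mem_rankCodes {K W p : ZFSet.{u}} :
    ZFSet.pair W p ∈ rankCodes K ↔ W ⊆ ZFSet.prod K K ∧ p ∈ K ∧ WellFounded (relOf W) := by
  rw [rankCodes, ZFSet.mem_sep, ZFSet.pair_mem_prod, ZFSet.mem_powerset, fst_pair, and_assoc]

open Classical in
/-- The rank of the point `p` in the relation `W`, where `d = (W, p)`. -/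
def codeRank (d : ZFSet.{u}) : Ordinal.{u + 1} :=
  if h : WellFounded (relOf (fst d)) then (h.apply (snd d)).rank else 0

/-- The comparison of ranks on `rankCodes K`. -/
def codeLt (K : ZFSet.{u}) : ZFSet.{u} :=
  ZFSet.sep (fun z => codeRank (fst z) < codeRank (snd z))
    (ZFSet.prod (rankCodes K) (rankCodes K))

theorem pair_mem_codeLt {K d d' : ZFSet.{u}} : ZFSet.pair d d' ∈ codeLt K ↔
    d ∈ rankCodes K ∧ d' ∈ rankCodes K ∧ codeRank d < codeRank d' := by
  rw [codeLt, ZFSet.mem_sep, ZFSet.pair_mem_prod, fst_pair, snd_pair, and_assoc]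

theorem pair_mem_codeLt_of_relOf {K W p q : ZFSet.{u}} (hW : W ⊆ ZFSet.prod K K)
    (hwf : WellFounded (relOf W)) (h : ZFSet.pair p q ∈ W) :
    ZFSet.pair (ZFSet.pair W p) (ZFSet.pair W q) ∈ codeLt K := by
  obtain ⟨hp, hq⟩ := ZFSet.pair_mem_prod.1 (hW h)
  refine pair_mem_codeLt.2 ⟨pair_mem_rankCodes.2 ⟨hW, hp, hwf⟩,
    pair_mem_rankCodes.2 ⟨hW, hq, hwf⟩, ?_⟩
  have hp' : WellFounded (relOf (fst (ZFSet.pair W p))) := by rwa [fst_pair]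
  have hq' : WellFounded (relOf (fst (ZFSet.pair W q))) := by rwa [fst_pair]
  rw [codeRank, codeRank, dif_pos hp', dif_pos hq']
  simp only [fst_pair, snd_pair]
  exact Acc.rank_lt_of_rel (hwf.apply q) h

theorem wellFounded_codeLt (K : ZFSet.{u}) : WellFounded (relOf (codeLt K)) :=
  Subrelation.wf (r := InvImage (· < ·) codeRank) (fun h => (pair_mem_codeLt.1 h).2.2)
    (InvImage.wf codeRank wellFounded_lt)

instance (W x : ZFSet.{u}) : Small.{u} {y // relOf W y x} :=
  small_of_injective (β := (⋃₀ (⋃₀ W) : ZFSet.{u})) (f := fun y => ⟨y.1, by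
    rw [ZFSet.mem_sUnion]
    refine ⟨{y.1}, ?_, by simp⟩
    rw [ZFSet.mem_sUnion]
    exact ⟨_, y.2, by simp [ZFSet.pair]⟩⟩) fun y z h => by
    simpa [Subtype.ext_iff] using h

/-- A map into the universe that turns comparison of ranks into membership. -/
def codeCollapse (K : ZFSet.{u}) : ZFSet.{u} → ZFSet.{u} := mostowski (wellFounded_codeLt K)

theorem codeCollapse_mem {K d d' : ZFSet.{u}} (h : ZFSet.pair d d' ∈ codeLt K) :
    codeCollapse K d ∈ codeCollapse K d' :=
  (mem_mostowski _).2 ⟨d, h, rfl⟩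

/-! ### Comparing representatives of codes, as an absolute notion -/

/-- `Z` is the set of pairs `(x, y)` in `k` with `l (f x) (g y)`. -/
def IsCompareSet (k l f g Z : ZFSet.{u}) : Prop :=
  (∀ z ∈ Z, z ∈ k) ∧ ∀ z ∈ k, z ∈ Z ↔ ∃ x y, z = ZFSet.pair x y ∧
    ∃ t ∈ l, ∃ u v, t = ZFSet.pair u v ∧ (ZFSet.pair x u ∈ f ∧ ZFSet.pair y v ∈ g)

instance (k l f g Z : ℕ) :
    Absolute fun v => IsCompareSet (v k) (v l) (v f) (v g) (v Z) := by
  unfold IsCompareSet; infer_instance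

/-- The comparison of representatives `p = (a, f)` and `q = (b, g)`, where `f, g ∈ D`, according to
the system of measures `y` on `k` and the relation `l`. -/
def IsStep (k l D y p q : ZFSet.{u}) : Prop :=
  ∃ a f, p = ZFSet.pair a f ∧ (f ∈ D ∧ ∃ b g, q = ZFSet.pair b g ∧ (g ∈ D ∧
    ∃ t ∈ y, ∃ m Z, t = ZFSet.pair m Z ∧ (m = ZFSet.pair a b ∧ IsCompareSet k l f g Z)))

instance (k l D y p q : ℕ) :
    Absolute fun v => IsStep (v k) (v l) (v D) (v y) (v p) (v q) := by
  unfold IsStep; infer_instance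

/-- The comparison of representatives in `T`, with the empty set added as a top element. -/
def IsBelow (T k l D y p q : ZFSet.{u}) : Prop :=
  (p ∈ T ∧ q ∈ T) ∧ (IsStep k l D y p q ∨ (q = ∅ ∧ ¬ p = ∅))

instance (T k l D y p q : ℕ) :
    Absolute fun v => IsBelow (v T) (v k) (v l) (v D) (v y) (v p) (v q) := by
  unfold IsBelow; infer_instance

/-- `W` is the set of pairs `(p, q)` for which `p` is below `q`. -/
def IsBelowSet (T k l D y W : ZFSet.{u}) : Prop :=
  (∀ z ∈ W, ∃ p q, z = ZFSet.pair p q ∧ IsBelow T k l D y p q) ∧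
    ∀ p ∈ T, ∀ q ∈ T, IsBelow T k l D y p q → ZFSet.pair p q ∈ W

instance (T k l D y W : ℕ) :
    Absolute fun v => IsBelowSet (v T) (v k) (v l) (v D) (v y) (v W) := by
  unfold IsBelowSet; infer_instance

theorem IsBelowSet.pair_mem_iff {T k l D y W : ZFSet.{u}} (h : IsBelowSet T k l D y W)
    {p q : ZFSet.{u}} : ZFSet.pair p q ∈ W ↔ IsBelow T k l D y p q := by
  constructor
  · intro hpq
    obtain ⟨p', q', h1, h2⟩ := h.1 _ hpq
    obtain ⟨rfl, rfl⟩ := ZFSet.pair_inj.1 h1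
    exact h2
  · exact fun hpq => h.2 p hpq.1.1 q hpq.1.2 hpq

theorem exists_isBelowSet (T k l D y : ZFSet.{u}) : ∃ W, IsBelowSet T k l D y W := by
  refine ⟨ZFSet.sep (fun z => ∃ p q, z = ZFSet.pair p q ∧ IsBelow T k l D y p q)
    (ZFSet.prod T T), fun z hz => (ZFSet.mem_sep.1 hz).2, fun p hp q hq h => ?_⟩
  exact ZFSet.mem_sep.2 ⟨ZFSet.pair_mem_prod.2 ⟨hp, hq⟩, p, q, rfl, h⟩

theorem pair_ne_empty (x y : ZFSet.{u}) : ZFSet.pair x y ≠ ∅ := by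
  intro h
  have : ({x} : ZFSet.{u}) ∈ ZFSet.pair x y := by simp [ZFSet.pair]
  rw [h] at this
  exact ZFSet.notMem_empty _ this

theorem IsStep.ne_empty {k l D y p q : ZFSet.{u}} (h : IsStep k l D y p q) : p ≠ ∅ ∧ q ≠ ∅ := by
  obtain ⟨a, f, rfl, -, b, g, rfl, -⟩ := h
  exact ⟨pair_ne_empty _ _, pair_ne_empty _ _⟩

/-- A nonempty set has only `IsStep` predecessors, all nonempty, and predecessors of `∅` are
nonempty; so adding `∅` on top creates no infinite descent. -/
theorem wellFounded_isBelow {T k l D y : ZFSet.{u}} (h : WellFounded (IsStep k l D y)) :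
    WellFounded (IsBelow T k l D y) := by
  have key : ∀ p, p ≠ ∅ → Acc (IsBelow T k l D y) p := by
    intro p
    induction p using h.induction with
    | h p ih =>
      intro hp
      refine ⟨_, fun q hq => ?_⟩
      rcases hq.2 with h1 | ⟨h1, -⟩
      · exact ih q h1 h1.ne_empty.1
      · exact absurd h1 hp
  refine ⟨fun p => ?_⟩
  refine ⟨_, fun q hq => key q ?_⟩
  rcases hq.2 with h1 | ⟨-, h1⟩
  · exact h1.ne_empty.1
  · exact h1

theorem empty_mem_vonNeumann {o : Ordinal.{u}} (ho : Order.IsSuccLimit o) :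
    (∅ : ZFSet.{u}) ∈ V_ o := by
  rw [ZFSet.mem_vonNeumann, ZFSet.rank_empty]
  exact ho.bot_lt

theorem rankCodes_mem_vonNeumann {o : Ordinal.{u}} (ho : Order.IsSuccLimit o) {K : ZFSet.{u}}
    (hK : K ∈ V_ o) : rankCodes K ∈ V_ o :=
  ZFSet.mem_vonNeumann_of_subset ZFSet.sep_subset
    (prod_mem_vonNeumann ho (powerset_mem_vonNeumann ho (prod_mem_vonNeumann ho hK hK)) hK)

theorem codeLt_mem_vonNeumann {o : Ordinal.{u}} (ho : Order.IsSuccLimit o) {K : ZFSet.{u}}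
    (hK : K ∈ V_ o) : codeLt K ∈ V_ o :=
  ZFSet.mem_vonNeumann_of_subset ZFSet.sep_subset
    (prod_mem_vonNeumann ho (rankCodes_mem_vonNeumann ho hK) (rankCodes_mem_vonNeumann ho hK))

/-! ### The comparison order of an extender and its height -/

namespace StrongnessEmbedding

variable {κ : Cardinal.{u}} {θ : Ordinal.{u}} {e e' : StrongnessEmbedding κ θ}

theorem value_congr (f g : ZFSet.{u} → ZFSet.{u})
    (h : graphOn (V_ κ.ord) f = graphOn (V_ κ.ord) g) (a : ZFSet.{u}) :
    e.value f a = e.value g a := by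
  rw [value, value, h]

theorem pair_mem_derivedExtender {a X : ZFSet.{u}} : ZFSet.pair a X ∈ derivedExtender e ↔
    (a ∈ V_ θ ∧ X ⊆ V_ κ.ord) ∧ a ∈ e.app X := by
  rw [derivedExtender, ZFSet.mem_sep, ZFSet.pair_mem_prod, ZFSet.mem_powerset]
  constructor
  · rintro ⟨h, a', X', h1, h2⟩
    obtain ⟨rfl, rfl⟩ := ZFSet.pair_inj.1 h1
    exact ⟨h, h2⟩
  · rintro ⟨h, h2⟩
    exact ⟨h, a, X, rfl, h2⟩

theorem isCompareSet_graphOn_iff {K l Z : ZFSet.{u}} {f g : ZFSet.{u} → ZFSet.{u}}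
    (hK : K.IsTransitive) :
    IsCompareSet K l (graphOn K f) (graphOn K g) Z ↔
      Z = ZFSet.sep (fun z => ∃ x y : ZFSet.{u}, z = ZFSet.pair x y ∧
        ZFSet.pair (f x) (g y) ∈ l) K := by
  have key : ∀ z ∈ K, (∃ x y, z = ZFSet.pair x y ∧ ∃ t ∈ l, ∃ u v, t = ZFSet.pair u v ∧
      (ZFSet.pair x u ∈ graphOn K f ∧ ZFSet.pair y v ∈ graphOn K g)) ↔
      ∃ x y : ZFSet.{u}, z = ZFSet.pair x y ∧ ZFSet.pair (f x) (g y) ∈ l := by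
    intro z hz
    refine exists_congr fun x => exists_congr fun y => and_congr_right fun h => ?_
    obtain ⟨hx, hy⟩ := mem_of_pair_mem hK (h ▸ hz)
    simp only [pair_mem_graphOn]
    constructor
    · rintro ⟨_, ht, _, _, rfl, ⟨-, rfl⟩, -, rfl⟩
      exact ht
    · exact fun ht => ⟨_, ht, _, _, rfl, ⟨hx, rfl⟩, hy, rfl⟩
  constructor
  · rintro ⟨h1, h2⟩
    ext z
    rw [ZFSet.mem_sep]
    constructor
    · exact fun hz => ⟨h1 z hz, (key z (h1 z hz)).1 ((h2 z (h1 z hz)).1 hz)⟩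
    · exact fun hz => (h2 z hz.1).2 ((key z hz.1).2 hz.2)
  · rintro rfl
    refine ⟨fun z hz => (ZFSet.mem_sep.1 hz).1, fun z hz => ?_⟩
    rw [key z hz, ZFSet.mem_sep, and_iff_right hz]

/-- The comparison of representatives in the ultrapower by `E` of elements of the image of
`rankCodes V_κ`. -/
abbrev ExtStep (κ : Cardinal.{u}) (E p q : ZFSet.{u}) : Prop :=
  IsStep (V_ κ.ord) (codeLt (V_ κ.ord)) (ZFSet.funs (V_ κ.ord) (rankCodes (V_ κ.ord))) E p q

/-- The comparison of representatives, with the empty set added as a top element. -/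
abbrev ExtBelow (κ : Cardinal.{u}) (θ : Ordinal.{u}) (E p q : ZFSet.{u}) : Prop :=
  IsBelow (V_ θ) (V_ κ.ord) (codeLt (V_ κ.ord)) (ZFSet.funs (V_ κ.ord) (rankCodes (V_ κ.ord)))
    E p q

namespace IsSeeded

theorem extStep_pair_iff (he : e.IsSeeded) {a b : ZFSet.{u}} (ha : a ∈ V_ θ) (hb : b ∈ V_ θ)
    {f g : ZFSet.{u} → ZFSet.{u}} (hf : ∀ x ∈ V_ κ.ord, f x ∈ rankCodes (V_ κ.ord))
    (hg : ∀ x ∈ V_ κ.ord, g x ∈ rankCodes (V_ κ.ord)) :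
    ExtStep κ (derivedExtender e) (ZFSet.pair a (graphOn (V_ κ.ord) f))
        (ZFSet.pair b (graphOn (V_ κ.ord) g)) ↔
      ZFSet.pair (e.value f a) (e.value g b) ∈ e.app (codeLt (V_ κ.ord)) := by
  have hK := ZFSet.isTransitive_vonNeumann κ.ord
  rw [← he.ultRel_iff (R := fun s x y => ZFSet.pair x y ∈ s) inferInstance (codeLt (V_ κ.ord))
    ha hb f g, UltRel]
  constructor
  · rintro ⟨a', f', h1, -, b', g', h2, -, _, ht, _, Z, rfl, rfl, hZ⟩
    obtain ⟨rfl, rfl⟩ := ZFSet.pair_inj.1 h1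
    obtain ⟨rfl, rfl⟩ := ZFSet.pair_inj.1 h2
    rw [isCompareSet_graphOn_iff hK] at hZ
    rwa [← hZ]
  · intro h
    exact ⟨a, _, rfl, ZFSet.mem_funs.2 (isFunc_graphOn hf), b, _, rfl,
      ZFSet.mem_funs.2 (isFunc_graphOn hg), _, h, _, _, rfl, rfl,
      (isCompareSet_graphOn_iff hK).2 rfl⟩

theorem exists_of_extStep (he : e.IsSeeded) {p q : ZFSet.{u}}
    (h : ExtStep κ (derivedExtender e) p q) :
    ∃ a ∈ V_ θ, ∃ b ∈ V_ θ, ∃ f g, p = ZFSet.pair a f ∧ q = ZFSet.pair b g ∧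
      ZFSet.IsFunc (V_ κ.ord) (rankCodes (V_ κ.ord)) f ∧
      ZFSet.IsFunc (V_ κ.ord) (rankCodes (V_ κ.ord)) g ∧
      ZFSet.pair (e.value (applySet f) a) (e.value (applySet g) b) ∈ e.app (codeLt (V_ κ.ord)) := by
  have h' := h
  obtain ⟨a, f, rfl, hf, b, g, rfl, hg, _, ht, _, Z, rfl, rfl, -⟩ := h
  have hab := mem_of_pair_mem (ZFSet.isTransitive_vonNeumann θ)
    (pair_mem_derivedExtender.1 ht).1.1
  rw [ZFSet.mem_funs] at hf hg
  refine ⟨a, hab.1, b, hab.2, f, g, rfl, rfl, hf, hg, ?_⟩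
  rw [← he.extStep_pair_iff hab.1 hab.2 (fun x => applySet_mem hf) (fun x => applySet_mem hg),
    graphOn_applySet hf, graphOn_applySet hg]
  exact h'

/-- Composing representatives with `codeCollapse` turns `codeLt` into membership pointwise, so by
elementarity each step becomes true membership between values of `j`. -/
theorem wellFounded_extStep (he : e.IsSeeded) : WellFounded (ExtStep κ (derivedExtender e)) := by
  refine Subrelation.wf (r := InvImage (· ∈ ·) fun p =>
    e.value (fun x => codeCollapse (V_ κ.ord) (applySet (snd p) x)) (fst p)) ?_
    (InvImage.wf _ ZFSet.mem_wf)
  intro p q h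
  obtain ⟨a, ha, b, hb, f, g, rfl, rfl, -, -, h⟩ := he.exists_of_extStep h
  simp only [InvImage, fst_pair, snd_pair]
  have h' := e.value_forall (P := fun l _ _ u v u' v' _ => ZFSet.pair u v ∈ l → u' ∈ v')
    inferInstance (codeLt (V_ κ.ord)) ∅ ∅ (fun z => applySet f (fst z))
    (fun z => applySet g (snd z)) (fun z => codeCollapse (V_ κ.ord) (applySet f (fst z)))
    (fun z => codeCollapse (V_ κ.ord) (applySet g (snd z))) (fun z => z)
    (fun x _ hx => codeCollapse_mem hx) (he.subset (he.pair_mem ha hb))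
  rw [he.value_fst ha hb (applySet f), he.value_snd ha hb (applySet g),
    he.value_fst ha hb fun z => codeCollapse (V_ κ.ord) (applySet f z),
    he.value_snd ha hb fun z => codeCollapse (V_ κ.ord) (applySet g z)] at h'
  exact h' h

theorem wellFounded_extBelow (he : e.IsSeeded) :
    WellFounded (ExtBelow κ θ (derivedExtender e)) :=
  wellFounded_isBelow he.wellFounded_extStep

/-- The height of the comparison of representatives in the ultrapower by an extender. -/
def height (he : e.IsSeeded) : Ordinal.{u + 1} := (he.wellFounded_extBelow.apply ∅).rank

theorem pair_mem_hull (he : e.IsSeeded) {x y : ZFSet.{u}} (hx : x ∈ e.hull) (hy : y ∈ e.hull) :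
    ZFSet.pair x y ∈ e.hull := by
  obtain ⟨w, hw, rfl⟩ := he.hull_exists (P := fun _ _ _ x y _ _ w => w = ZFSet.pair x y)
    inferInstance (s := ∅) (t := ∅) (r := ∅) (fun x y _ _ => ⟨_, rfl⟩) hx hy hx hx
  exact hw

theorem fst_mem_hull (he : e.IsSeeded) {x y : ZFSet.{u}} (h : ZFSet.pair x y ∈ e.hull) :
    x ∈ e.hull := by
  obtain ⟨w, hw, h'⟩ := he.hull_exists (P := fun _ _ _ z _ _ _ w =>
      (∃ x y, z = ZFSet.pair x y ∧ x = x) → ∃ x y, z = ZFSet.pair x y ∧ w = x)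
    inferInstance (s := ∅) (t := ∅) (r := ∅) (by
      intro z _ _ _
      by_cases hz : ∃ x y, z = ZFSet.pair x y
      · obtain ⟨x, y, rfl⟩ := hz
        exact ⟨x, fun _ => ⟨x, y, rfl, rfl⟩⟩
      · exact ⟨∅, fun ⟨x, y, h, _⟩ => absurd ⟨x, y, h⟩ hz⟩) h h h h
  obtain ⟨x', y', h1, rfl⟩ := h' ⟨x, y, rfl, rfl⟩
  obtain ⟨rfl, rfl⟩ := ZFSet.pair_inj.1 h1
  exact hw

theorem exists_mem_hull (he : e.IsSeeded) {s : ZFSet.{u}} (hs : s ∈ e.hull) (h : s ≠ ∅) :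
    ∃ x ∈ e.hull, x ∈ s := by
  obtain ⟨w, hw, h'⟩ := he.hull_exists (P := fun _ _ _ s _ _ _ w => ¬ s = ∅ → w ∈ s)
    inferInstance (s := ∅) (t := ∅) (r := ∅) (by
      intro s _ _ _
      by_cases h : s = ∅
      · exact ⟨∅, fun h' => absurd h h'⟩
      · obtain ⟨x, hx⟩ := (ZFSet.eq_empty_or_nonempty s).resolve_left h
        exact ⟨x, fun _ => hx⟩) hs hs hs hs
  exact ⟨w, hw, h' h⟩

theorem exists_pred_mem_hull (he : e.IsSeeded) {s W q : ZFSet.{u}} (hs : s ∈ e.hull)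
    (hW : W ∈ e.hull) (hq : q ∈ e.hull) (h : ∃ p ∈ s, ZFSet.pair p q ∈ W) :
    ∃ p ∈ e.hull, p ∈ s ∧ ZFSet.pair p q ∈ W := by
  obtain ⟨w, hw, h'⟩ := he.hull_exists (P := fun _ _ _ s W q _ w =>
      (∃ p ∈ s, ZFSet.pair p q ∈ W) → (w ∈ s ∧ ZFSet.pair w q ∈ W))
    inferInstance (s := ∅) (t := ∅) (r := ∅) (by
      intro s W q _
      by_cases h : ∃ p ∈ s, ZFSet.pair p q ∈ W
      · obtain ⟨p, hp⟩ := h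
        exact ⟨p, fun _ => hp⟩
      · exact ⟨∅, fun h' => absurd h' h⟩) hs hW hq hq
  exact ⟨w, hw, h' h⟩

theorem exists_value_mem_hull (he : e.IsSeeded) {g p : ZFSet.{u}} (r : ZFSet.{u})
    (hg : g ∈ e.hull) (hp : p ∈ e.hull) (h : ∃ d ∈ e.app r, ZFSet.pair p d ∈ g) :
    ∃ d ∈ e.hull, d ∈ e.app r ∧ ZFSet.pair p d ∈ g := by
  obtain ⟨w, hw, h'⟩ := he.hull_exists (P := fun r _ _ g p _ _ w =>
      (∃ d ∈ r, ZFSet.pair p d ∈ g) → (w ∈ r ∧ ZFSet.pair p w ∈ g))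
    inferInstance (s := r) (t := ∅) (r := ∅) (by
      intro g p _ _
      by_cases h : ∃ d ∈ r, ZFSet.pair p d ∈ g
      · obtain ⟨d, hd⟩ := h
        exact ⟨d, fun _ => hd⟩
      · exact ⟨∅, fun h' => absurd h' h⟩) hg hp hp hp
  exact ⟨w, hw, h' h⟩

-- Changing the representing function to a default where it leaves `r` does not affect its value at
-- `a`; representatives used in the comparison must map all of `V_κ` into the codes.
open Classical in
theorem exists_value_eq (he : e.IsSeeded) {r d₀ x : ZFSet.{u}} (hd₀ : d₀ ∈ r) (hx : x ∈ e.hull)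
    (hxr : x ∈ e.app r) :
    ∃ a ∈ V_ θ, ∃ f : ZFSet.{u} → ZFSet.{u}, (∀ z, f z ∈ r) ∧ e.value f a = x := by
  obtain ⟨a, ha, f, rfl⟩ := hx
  refine ⟨a, ha, fun z => if f z ∈ r then f z else d₀, fun z => ?_, ?_⟩
  · dsimp only
    split_ifs with h
    exacts [h, hd₀]
  · exact e.value_forall (P := fun r _ _ u v _ _ _ => u ∈ r → v = u) inferInstance r ∅ ∅ f
      (fun z => if f z ∈ r then f z else d₀) f f f (fun x _ hx => if_pos hx) (he.subset ha) hxr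

end IsSeeded

end StrongnessEmbedding

/-! ### Heights increase along the Mitchell order -/

/-- `w` is a nonempty set without minimal element for the relation coded by `W`. -/
def IsUnfounded (W w : ZFSet.{u}) : Prop := ¬ w = ∅ ∧ ∀ q ∈ w, ∃ p ∈ w, ZFSet.pair p q ∈ W

instance (W w : ℕ) : Absolute fun v => IsUnfounded (v W) (v w) := by
  unfold IsUnfounded; infer_instance

/-- `w` is a function on `K` with values in `R` that turns the relation coded by `W` into `l`. -/
def IsRanking (K R l W w : ZFSet.{u}) : Prop :=
  (∀ p ∈ K, ∃ d ∈ R, ZFSet.pair p d ∈ w) ∧ ∀ p ∈ K, ∀ q ∈ K, ZFSet.pair p q ∈ W →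
    ∀ d ∈ R, ∀ d' ∈ R, ZFSet.pair p d ∈ w → ZFSet.pair q d' ∈ w → ZFSet.pair d d' ∈ l

instance (K R l W w : ℕ) : Absolute fun v => IsRanking (v K) (v R) (v l) (v W) (v w) := by
  unfold IsRanking; infer_instance

/-- Well-foundedness is not visibly a bounded statement. Giving both it and its failure a witness
`w` makes the dichotomy absolute, so `hull_exists` can transfer it. -/
theorem exists_isUnfounded_or_isRanking (K W : ZFSet.{u}) (hW : W ⊆ ZFSet.prod K K) :
    ∃ w, IsUnfounded W w ∨ IsRanking K (rankCodes K) (codeLt K) W w := by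
  by_cases hwf : WellFounded (relOf W)
  · refine ⟨graphOn K fun p => ZFSet.pair W p, Or.inr ⟨fun p hp => ⟨_,
      pair_mem_rankCodes.2 ⟨hW, hp, hwf⟩, pair_mem_graphOn.2 ⟨hp, rfl⟩⟩, ?_⟩⟩
    intro p hp q hq hpq d _ d' _ hd hd'
    obtain ⟨-, rfl⟩ := pair_mem_graphOn.1 hd
    obtain ⟨-, rfl⟩ := pair_mem_graphOn.1 hd'
    exact pair_mem_codeLt_of_relOf hW hwf hpq
  · rw [WellFounded.wellFounded_iff_has_min] at hwf
    push Not at hwf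
    obtain ⟨s, ⟨q₀, hq₀⟩, hs⟩ := hwf
    have hsK : ∀ q ∈ s, ∃ p ∈ s, ZFSet.pair p q ∈ W := hs
    refine ⟨ZFSet.sep (· ∈ s) K, Or.inl ⟨?_, ?_⟩⟩
    · obtain ⟨p, hp, hpq⟩ := hsK q₀ hq₀
      intro h
      refine (ZFSet.eq_empty _).1 h p (ZFSet.mem_sep.2 ⟨?_, hp⟩)
      exact (ZFSet.pair_mem_prod.1 (hW hpq)).1
    · intro q hq
      obtain ⟨p, hp, hpq⟩ := hsK q (ZFSet.mem_sep.1 hq).2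
      exact ⟨p, ZFSet.mem_sep.2 ⟨(ZFSet.pair_mem_prod.1 (hW hpq)).1, hp⟩, hpq⟩

namespace StrongnessEmbedding

variable {κ : Cardinal.{u}} {θ : Ordinal.{u}} {e e' : StrongnessEmbedding κ θ}

namespace IsSeeded

theorem exists_hull_isUnfounded_or_isRanking (he : e.IsSeeded) {W : ZFSet.{u}} (hW : W ∈ e.hull)
    (hWK : ∀ z ∈ W, ∃ p q, z = ZFSet.pair p q ∧ (p ∈ e.app (V_ κ.ord) ∧ q ∈ e.app (V_ κ.ord))) :
    ∃ w ∈ e.hull, IsUnfounded W w ∨ IsRanking (e.app (V_ κ.ord)) (e.app (rankCodes (V_ κ.ord)))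
      (e.app (codeLt (V_ κ.ord))) W w := by
  obtain ⟨w, hw, h⟩ := he.hull_exists (P := fun K R l W _ _ _ w =>
      (∀ z ∈ W, ∃ p q, z = ZFSet.pair p q ∧ (p ∈ K ∧ q ∈ K)) →
      (IsUnfounded W w ∨ IsRanking K R l W w)) inferInstance
    (s := V_ κ.ord) (t := rankCodes (V_ κ.ord)) (r := codeLt (V_ κ.ord)) (by
      intro W _ _ _
      by_cases hW : W ⊆ ZFSet.prod (V_ κ.ord) (V_ κ.ord)
      · obtain ⟨w, hw⟩ := exists_isUnfounded_or_isRanking (V_ κ.ord) W hW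
        exact ⟨w, fun _ => hw⟩
      · refine ⟨∅, fun h => absurd (fun z hz => ?_) hW⟩
        obtain ⟨p, q, rfl, hp, hq⟩ := h z hz
        exact ZFSet.pair_mem_prod.2 ⟨hp, hq⟩) hW hW hW hW
  exact ⟨w, hw, h hWK⟩

theorem exists_hull_isBelowSet (he : e.IsSeeded) {k l D y : ZFSet.{u}} (hk : k ∈ e.hull)
    (hl : l ∈ e.hull) (hD : D ∈ e.hull) (hy : y ∈ e.hull) :
    ∃ W ∈ e.hull, IsBelowSet (e.app (V_ κ.ord)) k l D y W :=
  he.hull_exists (P := fun T _ _ k l D y W => IsBelowSet T k l D y W) inferInstance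
    (s := V_ κ.ord) (t := ∅) (r := ∅) (fun k l D y => exists_isBelowSet _ k l D y) hk hl hD hy

/-- The measure entry `((a, b), Z)` witnessing the step lies in the hull, since `Z ⊆ k ∈ V_θ`. Being
in `y`, it lies in `V_θ` and belongs to `E`, which also puts `a` and `b` in `V_θ`. -/
theorem isStep_of_collapse_eq (he : e.IsSeeded) {k l D y E p q : ZFSet.{u}} (hk : k ∈ V_ θ)
    (hD : D ∈ V_ θ) (hE : E ⊆ V_ θ) (hyE : e.collapse y = E) (hp : p ∈ e.hull) (hq : q ∈ e.hull)
    (h : IsStep k l D y p q) : (p ∈ V_ θ ∧ q ∈ V_ θ) ∧ IsStep k l D E p q := by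
  obtain ⟨a, f, rfl, hf, b, g, rfl, hg, t, ht, m, Z, rfl, rfl, hZ⟩ := h
  have hT := ZFSet.isTransitive_vonNeumann θ
  have hfV := hT _ hD hf
  have hgV := hT _ hD hg
  have hZV : Z ∈ V_ θ := ZFSet.mem_vonNeumann_of_subset (fun z hz => hZ.1 z hz) hk
  have htV := he.mem_vonNeumann_of_collapse_eq hyE hE (he.pair_mem_hull
    (he.pair_mem_hull (he.fst_mem_hull hp) (he.fst_mem_hull hq)) (he.mem_hull hZV)) ht
  obtain ⟨ha, hb⟩ := mem_of_pair_mem hT (mem_of_pair_mem hT htV).1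
  exact ⟨⟨he.pair_mem ha hfV, he.pair_mem hb hgV⟩, a, f, rfl, hf, b, g, rfl, hg, _,
    (he.mem_iff_mem_of_collapse_eq hyE htV).2 ht, _, Z, rfl, rfl, hZ⟩

/-- Predecessors in `w` can be chosen in the hull, and then they lie in `V_θ`, where `W` agrees with
the well-founded comparison for `E`. An unfounded `w` would give descent there. -/
theorem not_isUnfounded (he : e.IsSeeded) {k l D y E W w : ZFSet.{u}} (hk : k ∈ V_ θ)
    (hD : D ∈ V_ θ) (hE : E ⊆ V_ θ) (hyE : e.collapse y = E)
    (hwf : WellFounded (IsBelow (V_ θ) k l D E)) (hW : W ∈ e.hull)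
    (hWB : IsBelowSet (e.app (V_ κ.ord)) k l D y W) (hw : w ∈ e.hull) : ¬ IsUnfounded W w := by
  rintro ⟨hne, hpred⟩
  have step : ∀ q ∈ e.hull, q ∈ w → ∃ p ∈ e.hull, p ∈ w ∧ p ∈ V_ θ ∧
      (q ∈ V_ θ → IsBelow (V_ θ) k l D E p q) := by
    intro q hq hqw
    obtain ⟨p, hp, hpw, hpq⟩ := he.exists_pred_mem_hull hw hW hq (hpred q hqw)
    refine ⟨p, hp, hpw, ?_⟩
    rcases (hWB.pair_mem_iff.1 hpq).2 with h | ⟨rfl, hp0⟩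
    · obtain ⟨⟨h1, h2⟩, h3⟩ := he.isStep_of_collapse_eq hk hD hE hyE hp hq h
      exact ⟨h1, fun _ => ⟨⟨h1, h2⟩, Or.inl h3⟩⟩
    -- Below the top element `∅`, `p` is only known to lie in `j(V_κ)`. One more predecessor `r`
    -- gives a genuine step into `p`, which forces `p ∈ V_θ`.
    · obtain ⟨r, hr, hrw, hrp⟩ := he.exists_pred_mem_hull hw hW hp (hpred p hpw)
      rcases (hWB.pair_mem_iff.1 hrp).2 with h | ⟨h, -⟩
      · obtain ⟨⟨-, h2⟩, -⟩ := he.isStep_of_collapse_eq hk hD hE hyE hr hp h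
        exact ⟨h2, fun hq => ⟨⟨h2, hq⟩, Or.inr ⟨rfl, hp0⟩⟩⟩
      · exact absurd h hp0
  have none : ∀ q, q ∈ V_ θ → q ∉ w := by
    intro q
    induction q using hwf.induction with
    | h q ih =>
      intro hq hqw
      obtain ⟨p, -, hpw, hp, h⟩ := step q (he.mem_hull hq) hqw
      exact ih p (h hq) hp hpw
  obtain ⟨q, hq, hqw⟩ := he.exists_mem_hull hw hne
  obtain ⟨p, -, hpw, hp, -⟩ := step q hq hqw
  exact none p hp hpw

theorem isBelow_of_collapse_eq (he : e.IsSeeded) {k l D y E p q : ZFSet.{u}}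
    (hE : E ⊆ V_ θ) (hyE : e.collapse y = E) (h : IsBelow (V_ θ) k l D E p q) :
    IsBelow (e.app (V_ κ.ord)) k l D y p q := by
  refine ⟨⟨he.subset h.1.1, he.subset h.1.2⟩, h.2.imp_left ?_⟩
  rintro ⟨a, f, rfl, hf, b, g, rfl, hg, t, ht, h⟩
  exact ⟨a, f, rfl, hf, b, g, rfl, hg, t, (he.mem_iff_mem_of_collapse_eq hyE (hE ht)).1 ht, h⟩

theorem pair_empty_mem_rankCodes (hκ : Order.IsSuccLimit κ.ord) :
    ZFSet.pair ∅ ∅ ∈ rankCodes (V_ κ.ord) :=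
  pair_mem_rankCodes.2 ⟨ZFSet.empty_subset _, empty_mem_vonNeumann hκ,
    ⟨fun _ => ⟨_, fun _ hq => absurd hq (ZFSet.notMem_empty _)⟩⟩⟩

theorem height_lt_height (he : e.IsSeeded) (he' : e'.IsSeeded) (hκ : κ.ord < θ) {y : ZFSet.{u}}
    (hy : y ∈ e.hull) (hyE : e.collapse y = derivedExtender e') : he'.height < he.height := by
  have hθ := he.isSuccLimit
  have hE : derivedExtender e' ⊆ V_ θ := derivedExtender_subset hθ hκ
  have hK : V_ κ.ord ∈ V_ θ := ZFSet.vonNeumann_mem_of_lt hκ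
  have hl := codeLt_mem_vonNeumann hθ hK
  have hR := rankCodes_mem_vonNeumann hθ hK
  have hD := funs_mem_vonNeumann hθ hK hR
  -- `W` is the comparison for `y` as the hull sees it, on the domain `j(V_κ)`, with the codes for
  -- `V_κ` itself as parameters. A ranking `g` of it takes values in `j(rankCodes V_κ)`.
  obtain ⟨W, hW, hWB⟩ := he.exists_hull_isBelowSet (he.mem_hull hK) (he.mem_hull hl)
    (he.mem_hull hD) hy
  obtain ⟨g, hg, hunf | ⟨hg1, hg2⟩⟩ := he.exists_hull_isUnfounded_or_isRanking hW (by
    intro z hz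
    obtain ⟨p, q, rfl, h⟩ := hWB.1 z hz
    exact ⟨p, q, rfl, h.1⟩)
  · exact absurd hunf (he.not_isUnfounded hK hD hE hyE he'.wellFounded_extBelow hW hWB hg)
  -- Each `p ∈ V_θ` gets a representative of a value of `g` at `p`; other points get the constant
  -- code `(∅, ∅)`, which is never compared.
  have hex : ∀ p : ZFSet.{u}, ∃ c ∈ V_ θ, ∃ f : ZFSet.{u} → ZFSet.{u},
      (∀ z, f z ∈ rankCodes (V_ κ.ord)) ∧ (p ∈ V_ θ → ZFSet.pair p (e.value f c) ∈ g ∧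
        e.value f c ∈ e.app (rankCodes (V_ κ.ord))) := by
    intro p
    have h0 := pair_empty_mem_rankCodes e.isSuccLimit_ord
    by_cases hp : p ∈ V_ θ
    · obtain ⟨d, hd, hdR, hdg⟩ := he.exists_value_mem_hull _ hg (he.mem_hull hp)
        (hg1 p (he.subset hp))
      obtain ⟨c, hc, f, hf, rfl⟩ := he.exists_value_eq h0 hd hdR
      exact ⟨c, hc, f, hf, fun _ => ⟨hdg, hdR⟩⟩
    · exact ⟨∅, he.empty_mem, fun _ => ZFSet.pair ∅ ∅, fun _ => h0, fun h => absurd h hp⟩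
  choose c hc f hf hfg using hex
  have hmem : ∀ p, ZFSet.pair (c p) (graphOn (V_ κ.ord) (f p)) ∈ V_ θ := fun p =>
    he.pair_mem (hc p) (ZFSet.isTransitive_vonNeumann θ _ hD
      (ZFSet.mem_funs.2 (isFunc_graphOn fun x _ => hf p x)))
  have hmap : ∀ p q, ExtBelow κ θ (derivedExtender e') p q → ExtBelow κ θ (derivedExtender e)
      (ZFSet.pair (c p) (graphOn (V_ κ.ord) (f p)))
      (ZFSet.pair (c q) (graphOn (V_ κ.ord) (f q))) := by
    intro p q h
    refine ⟨⟨hmem p, hmem q⟩, Or.inl ?_⟩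
    refine (he.extStep_pair_iff (hc p) (hc q) (fun x _ => hf p x) (fun x _ => hf q x)).2 ?_
    have hW := hWB.pair_mem_iff.2 (he.isBelow_of_collapse_eq hE hyE h)
    exact hg2 p (he.subset h.1.1) q (he.subset h.1.2) hW _ (hfg p h.1.1).2 _ (hfg q h.1.2).2
      (hfg p h.1.1).1 (hfg q h.1.2).1
  -- The old top `∅` is sent to a nonempty representative, hence strictly below the new top; this
  -- makes the inequality strict.
  refine (rank_le_rank_of_map he'.wellFounded_extBelow he.wellFounded_extBelow hmap ∅).trans_lt ?_
  exact Acc.rank_lt_of_rel (he.wellFounded_extBelow.apply ∅)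
    ⟨⟨hmem ∅, he.empty_mem⟩, Or.inr ⟨rfl, pair_ne_empty _ _⟩⟩

end IsSeeded

end StrongnessEmbedding

/-- The Mitchell order is well-founded. -/
theorem isWellFounded_mitchellOrder {κ : Cardinal.{u}} {θ : Ordinal.{u}}
    (hθ : Order.IsSuccLimit θ) (hκ : κ.ord < θ) : IsWellFounded _ (MitchellOrder κ θ) := by
  have hex : ∀ E : {E : ZFSet.{u} // IsExtender κ θ E}, ∃ e : StrongnessEmbedding κ θ,
      e.IsSeeded ∧ E.1 = derivedExtender e := by
    rintro ⟨E, e, h1, h2⟩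
    exact ⟨e, ⟨hθ, h1⟩, h2⟩
  choose e he hE using hex
  refine ⟨Subrelation.wf (r := InvImage (· < ·) fun E => (he E).height) ?_
    (InvImage.wf _ wellFounded_lt)⟩
  intro E F h
  unfold MitchellOrder at h
  rw [hE F, (he F).mem_collapsedUltrapower_iff] at h
  obtain ⟨y, hy, h⟩ := h
  exact (he F).height_lt_height (he E) hκ hy (h.trans (hE E))

/-! ### The upper bound: few predecessors -/

namespace StrongnessEmbedding

variable {κ : Cardinal.{u}} {θ : Ordinal.{u}} {e : StrongnessEmbedding κ θ}

/-- The set represented in the transitive collapse by the pair of a seed and a coded function. -/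
def decode (e : StrongnessEmbedding κ θ) (z : ZFSet.{u}) : ZFSet.{u} :=
  e.collapse (e.value (applySet (snd z)) (fst z))

/-- Cutting the representing function down to `f x ∩ V_κ` makes it an element of `V_θ`. The collapse
is unchanged, since the hull elements of `y` lie in `V_θ ⊆ j(V_κ)`. -/
theorem IsSeeded.exists_decode_eq (he : e.IsSeeded) (hκ : κ.ord < θ) {y E : ZFSet.{u}}
    (hy : y ∈ e.hull) (hyE : e.collapse y = E) (hE : E ⊆ V_ θ) : ∃ z ∈ V_ θ, e.decode z = E := by
  obtain ⟨a, ha, f, rfl⟩ := hy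
  have hK : V_ κ.ord ∈ V_ θ := ZFSet.vonNeumann_mem_of_lt hκ
  have hg : ZFSet.IsFunc (V_ κ.ord) (ZFSet.powerset (V_ κ.ord))
      (graphOn (V_ κ.ord) fun x => f x ∩ V_ κ.ord) :=
    isFunc_graphOn fun x _ => by
      rw [ZFSet.mem_powerset]
      exact fun z hz => (ZFSet.mem_inter.1 hz).2
  have hgV : graphOn (V_ κ.ord) (fun x => f x ∩ V_ κ.ord) ∈ V_ θ :=
    ZFSet.isTransitive_vonNeumann θ _ (funs_mem_vonNeumann he.isSuccLimit hK
      (powerset_mem_vonNeumann he.isSuccLimit hK)) (ZFSet.mem_funs.2 hg)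
  refine ⟨ZFSet.pair a (graphOn (V_ κ.ord) fun x => f x ∩ V_ κ.ord), he.pair_mem ha hgV, ?_⟩
  rw [decode, fst_pair, snd_pair, value_congr _ _ (graphOn_applySet hg)]
  have h := e.value_forall (P := fun K _ _ u v _ _ _ =>
      (∀ x ∈ v, x ∈ u) ∧ ∀ x ∈ u, x ∈ K → x ∈ v) inferInstance (V_ κ.ord) ∅ ∅ f
    (fun x => f x ∩ V_ κ.ord) f f f (fun x _ => ⟨fun z hz => (ZFSet.mem_inter.1 hz).1,
      fun z hz hzK => ZFSet.mem_inter.2 ⟨hz, hzK⟩⟩) (he.subset ha)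
  rw [← hyE]
  ext z
  rw [e.mem_collapse, e.mem_collapse]
  refine exists_congr fun x => and_congr_right fun hx => and_congr_left fun _ => ⟨h.1 x, fun hxy => ?_⟩
  exact h.2 x hxy (he.subset (he.mem_vonNeumann_of_collapse_eq hyE hE hx hxy))

theorem omega0_add_eq (e : StrongnessEmbedding κ θ) (hκ : κ.ord < θ) :
    Ordinal.omega0 + θ = θ := by
  have h1 : Ordinal.omega0 + κ.ord = κ.ord :=
    (Ordinal.isPrincipal_add_ord
      (Cardinal.omega0_le_ord.1 e.omega0_lt_ord.le)).add_eq_right e.omega0_lt_ord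
  rw [← Ordinal.add_sub_cancel_of_le hκ.le, ← add_assoc, h1]

/-- `V_θ` has `preBeth θ` elements, while `ℶ_θ` is `preBeth (ω + θ)`; the shift by `ω` is absorbed
because `ω < κ < θ`. -/
theorem card_vonNeumann_eq (e : StrongnessEmbedding κ θ) (hκ : κ.ord < θ) :
    (V_ θ).card = ℶ_ θ := by
  rw [ZFSet.card_vonNeumann, Cardinal.beth_eq_preBeth, e.omega0_add_eq hκ]

end StrongnessEmbedding

variable {κ : Cardinal.{u}} {θ : Ordinal.{u}}

theorem mk_mitchellOrder_le (hθ : Order.IsSuccLimit θ) (hκ : κ.ord < θ)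
    (F : {E : ZFSet.{u} // IsExtender κ θ E}) :
    #{E // MitchellOrder κ θ E F} ≤ Cardinal.lift.{u + 1} (ℶ_ θ) := by
  obtain ⟨F, e, h1, rfl⟩ := F
  have he : e.IsSeeded := ⟨hθ, h1⟩
  rw [← e.card_vonNeumann_eq hκ, ← ZFSet.cardinalMk_coe_sort]
  have hex : ∀ E : {E // MitchellOrder κ θ E ⟨derivedExtender e, e, h1, rfl⟩},
      ∃ z ∈ V_ θ, e.decode z = E.1.1 := by
    rintro ⟨⟨E, e', h1', rfl⟩, hE⟩
    unfold MitchellOrder at hE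
    rw [he.mem_collapsedUltrapower_iff] at hE
    obtain ⟨y, hy, hyE⟩ := hE
    exact he.exists_decode_eq hκ hy hyE (StrongnessEmbedding.derivedExtender_subset hθ hκ)
  choose z hz hzE using hex
  refine Cardinal.mk_le_of_injective (f := fun E => ⟨z E, hz E⟩) fun E E' h => ?_
  have h' : z E = z E' := congrArg Subtype.val h
  exact Subtype.ext (Subtype.ext (by rw [← hzE, ← hzE, h']))

theorem rank_mitchellOrder_lt (hθ : Order.IsSuccLimit θ) (hκ : κ.ord < θ)
    [IsWellFounded _ (MitchellOrder κ θ)] (F : {E : ZFSet.{u} // IsExtender κ θ E}) :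
    IsWellFounded.rank (MitchellOrder κ θ) F <
      Ordinal.lift.{u + 1} (Order.succ (ℶ_ θ)).ord := by
  induction F using IsWellFounded.induction (MitchellOrder κ θ) with
  | ind F ih =>
    rw [IsWellFounded.rank_eq]
    have hreg : (Order.succ (Cardinal.lift.{u + 1} (ℶ_ θ))).IsRegular :=
      Cardinal.isRegular_succ (by
        rw [Cardinal.aleph0_le_lift]; exact Cardinal.aleph0_le_beth θ)
    rw [Cardinal.lift_ord, Cardinal.lift_succ] at ih ⊢
    refine Ordinal.iSup_add_one_lt_of_lt_cof ?_ fun b => ih b b.2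
    rw [hreg.cof_ord, Order.lt_succ_iff]
    exact mk_mitchellOrder_le hθ hκ F

/-! ### The lower bound: guessing subsets of `V_θ` -/

/-- `z` belongs to the first component `u` of some pair `(u, v)` that one of the functions listed in
`t`, at an index in `s ∩ x`, takes as its value at `x`. -/
def IsGuessed (s t x z : ZFSet.{u}) : Prop :=
  ∃ ξ ∈ s, ξ ∈ x ∧ ∃ c ∈ t, ∃ ξ' m, c = ZFSet.pair ξ' m ∧ (ξ' = ξ ∧ ∃ c' ∈ m, ∃ x' b,
    c' = ZFSet.pair x' b ∧ (x' = x ∧ ∃ u v, b = ZFSet.pair u v ∧ z ∈ u))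

instance (s t x z : ℕ) : Absolute fun v => IsGuessed (v s) (v t) (v x) (v z) := by
  unfold IsGuessed; infer_instance

/-- `w` is the set of all `z` with `IsGuessed s t x z`. -/
def IsGuessedSet (s t x w : ZFSet.{u}) : Prop :=
  (∀ z ∈ w, IsGuessed s t x z) ∧ ¬ ∃ ξ ∈ s, ξ ∈ x ∧ ∃ c ∈ t, ∃ ξ' m, c = ZFSet.pair ξ' m ∧
    (ξ' = ξ ∧ ∃ c' ∈ m, ∃ x' b, c' = ZFSet.pair x' b ∧
      (x' = x ∧ ∃ u v, b = ZFSet.pair u v ∧ ¬ u ⊆ w))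

instance (s t x w : ℕ) : Absolute fun v => IsGuessedSet (v s) (v t) (v x) (v w) := by
  unfold IsGuessedSet; infer_instance

theorem exists_isGuessedSet (s t x : ZFSet.{u}) : ∃ w, IsGuessedSet s t x w := by
  -- `V_ t.rank` is a bounding set: every guessed `z` lies in the transitive closure of `t`.
  refine ⟨ZFSet.sep (IsGuessed s t x) (V_ t.rank), fun z hz => (ZFSet.mem_sep.1 hz).2, ?_⟩
  rintro ⟨_, hs, hx, _, hc, _, m, rfl, rfl, _, hm, _, _, rfl, rfl, u, v, rfl, h⟩
  refine h fun z hz => ZFSet.mem_sep.2 ⟨?_, _, hs, hx, _, hc, _, m, rfl, rfl, _, hm, _, _, rfl, rfl,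
    u, v, rfl, hz⟩
  have hT := ZFSet.isTransitive_vonNeumann t.rank
  have h1 := (mem_of_pair_mem hT (ZFSet.subset_vonNeumann_self t hc)).2
  have h2 := (mem_of_pair_mem hT (hT _ h1 hm)).2
  exact hT _ (mem_of_pair_mem hT h2).1 hz

theorem IsGuessedSet.mem_iff {s t x w z : ZFSet.{u}} (h : IsGuessedSet s t x w) :
    z ∈ w ↔ IsGuessed s t x z := by
  refine ⟨h.1 z, ?_⟩
  rintro ⟨ξ, hs, hx, c, hc, ξ', m, h1, h2, c', hm, x', b, h3, h4, u, v, h5, h6⟩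
  by_contra hz
  exact h.2 ⟨ξ, hs, hx, c, hc, ξ', m, h1, h2, c', hm, x', b, h3, h4, u, v, h5, fun hu => hz (hu h6)⟩

variable {κ : Cardinal.{u}} {θ : Ordinal.{u}}

namespace StrongnessEmbedding

variable {e : StrongnessEmbedding κ θ}

theorem eq_of_pair_mem_app {K Y f x y y' : ZFSet.{u}} (hf : ZFSet.IsFunc K Y f)
    (h : ZFSet.pair x y ∈ e.app f) (h' : ZFSet.pair x y' ∈ e.app f) : y = y' := by
  have key := (e.app_iff (P := fun v => ∀ z ∈ v 0, ∀ z' ∈ v 0, ∃ x y, z = ZFSet.pair x y ∧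
      ∃ x' y', z' = ZFSet.pair x' y' ∧ (x = x' → y = y'))
    inferInstance fun n => [f].getD n ∅).2 (by
      intro z hz z' hz'
      obtain ⟨x, hx, y, -, rfl⟩ := ZFSet.mem_prod.1 (hf.1 hz)
      obtain ⟨x', -, y', -, rfl⟩ := ZFSet.mem_prod.1 (hf.1 hz')
      refine ⟨x, y, rfl, x', y', rfl, ?_⟩
      rintro rfl
      exact (hf.2 x hx).unique hz hz')
  obtain ⟨x₁, y₁, h1, x₂, y₂, h2, h3⟩ := key _ h _ h'
  obtain ⟨rfl, rfl⟩ := ZFSet.pair_inj.1 h1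
  obtain ⟨rfl, rfl⟩ := ZFSet.pair_inj.1 h2
  exact h3 rfl

theorem mem_app_of_pair_mem_app {K Y f x y : ZFSet.{u}} (hf : ZFSet.IsFunc K Y f)
    (h : ZFSet.pair x y ∈ e.app f) : y ∈ e.app Y := by
  have key := (e.app_iff (P := fun v => ∀ z ∈ v 0, ∃ x y, z = ZFSet.pair x y ∧ y ∈ v 1)
    inferInstance fun n => [f, Y].getD n ∅).2 (by
      intro z hz
      obtain ⟨x, -, y, hy, rfl⟩ := ZFSet.mem_prod.1 (hf.1 hz)
      exact ⟨x, y, rfl, hy⟩)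
  obtain ⟨x₁, y₁, h1, h2⟩ := key _ h
  obtain ⟨rfl, rfl⟩ := ZFSet.pair_inj.1 h1
  exact h2

/-- A sequence of sets indexed by the ordinals below `lam`, coded as a set of pairs. -/
def sequenceGraph (lam : Ordinal.{u}) (ℓ : Ordinal.{u} → ZFSet.{u}) : ZFSet.{u} :=
  ZFSet.range fun α : Set.Iio lam => ZFSet.pair α.1.toZFSet (ℓ α)

theorem mem_sequenceGraph {lam : Ordinal.{u}} {ℓ : Ordinal.{u} → ZFSet.{u}} {z : ZFSet.{u}} :
    z ∈ sequenceGraph lam ℓ ↔ ∃ α < lam, ZFSet.pair α.toZFSet (ℓ α) = z := by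
  simp [sequenceGraph]

theorem app_toZFSet (e : StrongnessEmbedding κ θ) {α : Ordinal.{u}} (hα : α < κ.ord) :
    e.app α.toZFSet = α.toZFSet := e.fixes_below α hα

theorem pair_mem_app_sequenceGraph {lam α : Ordinal.{u}} {ℓ : Ordinal.{u} → ZFSet.{u}}
    (hα : α < lam) (hακ : α < κ.ord) {m : ZFSet.{u}} :
    ZFSet.pair α.toZFSet m ∈ e.app (sequenceGraph lam ℓ) ↔ m = e.app (ℓ α) := by
  constructor
  · intro h
    have key := (e.app_iff (P := fun v => ∀ z ∈ v 0, ∃ x y, z = ZFSet.pair x y ∧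
        (x = v 1 → y = v 2))
      inferInstance fun n => [sequenceGraph lam ℓ, α.toZFSet, ℓ α].getD n ∅).2 (by
        intro z hz
        obtain ⟨β, -, rfl⟩ := mem_sequenceGraph.1 hz
        refine ⟨_, _, rfl, fun h => ?_⟩
        rw [Ordinal.toZFSet_injective h]
        rfl)
    obtain ⟨x, y, h1, h2⟩ := key _ h
    obtain ⟨rfl, rfl⟩ := ZFSet.pair_inj.1 h1
    exact h2 (e.app_toZFSet hακ).symm
  · rintro rfl
    rw [← e.app_toZFSet hακ, ← e.app_pair, e.app_mem_app]
    exact mem_sequenceGraph.2 ⟨α, hα, rfl⟩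

/-- Restricting indices to `j(lam) ∩ κ` recovers exactly those below `lam`, even when `lam = κ`; at
these, `j` of the sequence takes the value `j(ℓ α)`. -/
theorem isGuessed_iff {lam : Ordinal.{u}} (hlam : lam ≤ κ.ord) {ℓ a b : Ordinal.{u} → ZFSet.{u}}
    (hℓ : ∀ α < lam, ∃ K Y, ZFSet.IsFunc K Y (ℓ α))
    (hg : ∀ α < lam, Guesses e (ℓ α) (ZFSet.pair (a α) (b α))) {z : ZFSet.{u}} :
    IsGuessed (e.app lam.toZFSet) (e.app (sequenceGraph lam ℓ)) κ.ord.toZFSet z ↔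
      ∃ α < lam, z ∈ a α := by
  constructor
  · rintro ⟨ξ, hs, hx, _, hc, _, m, rfl, rfl, _, hm, _, _, rfl, rfl, u, v, rfl, h⟩
    obtain ⟨α, hακ, rfl⟩ := Ordinal.mem_toZFSet_iff.1 hx
    have hα : α < lam := by
      rwa [← e.app_toZFSet hακ, e.app_mem_app, Ordinal.toZFSet_mem_toZFSet_iff] at hs
    rw [pair_mem_app_sequenceGraph hα hακ] at hc
    obtain ⟨K, Y, hf⟩ := hℓ α hα
    have h1 := eq_of_pair_mem_app hf (hc ▸ hm) (hg α hα)
    obtain ⟨rfl, rfl⟩ := ZFSet.pair_inj.1 h1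
    exact ⟨α, hα, h⟩
  · rintro ⟨α, hα, hz⟩
    have hακ := hα.trans_le hlam
    refine ⟨α.toZFSet, ?_, ?_, _, (pair_mem_app_sequenceGraph hα hακ).2 rfl, _, _, rfl, rfl, _,
      hg α hα, _, _, rfl, rfl, _, _, rfl, hz⟩
    · rwa [← e.app_toZFSet hακ, e.app_mem_app, Ordinal.toZFSet_mem_toZFSet_iff]
    · exact Ordinal.toZFSet_mem_toZFSet_iff.2 hακ

/-- The hull contains the section at `i ∈ V_θ` of each of its elements. -/
theorem IsSeeded.section_mem_hull (he : e.IsSeeded) {A B i : ZFSet.{u}} (hA : A ∈ e.hull)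
    (hi : i ∈ V_ θ) (hB : ∀ z, z ∈ B ↔ ZFSet.pair i z ∈ A) : B ∈ e.hull := by
  obtain ⟨w, hw, h1, h2⟩ := he.hull_exists (P := fun _ _ _ A i _ _ w =>
      (∀ z ∈ w, ZFSet.pair i z ∈ A) ∧ ¬ ∃ c ∈ A, ∃ x z, c = ZFSet.pair x z ∧ (x = i ∧ z ∉ w))
    inferInstance (s := ∅) (t := ∅) (r := ∅) (by
      intro A i _ _
      refine ⟨ZFSet.sep (fun z => ZFSet.pair i z ∈ A) (V_ A.rank),
        fun z hz => (ZFSet.mem_sep.1 hz).2, ?_⟩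
      rintro ⟨_, hc, _, z, rfl, rfl, hz⟩
      exact hz (ZFSet.mem_sep.2 ⟨(mem_of_pair_mem (ZFSet.isTransitive_vonNeumann _)
        (ZFSet.subset_vonNeumann_self A hc)).2, hc⟩)) hA (he.mem_hull hi) hA hA
  have : B = w := by
    ext z
    rw [hB]
    refine ⟨fun hz => ?_, h1 z⟩
    by_contra hzw
    exact h2 ⟨_, hz, _, _, rfl, rfl, hzw⟩
  rwa [this]

end StrongnessEmbedding

open StrongnessEmbedding

/-- `A` is the union of its guessed pieces, a set definable from `j` of the Laver sequence, `j(cf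
θ)` and the seed `κ`, hence in the hull. -/
theorem IsJointLaverSequence.exists_mem_hull {ℓ : Ordinal.{u} → ZFSet.{u}}
    (hℓ : IsJointLaverSequence κ θ θ.cof.ord ℓ) (hθ : Order.IsSuccLimit θ) (hcof : θ.cof ≤ κ)
    (hκ : κ.ord < θ) {A : ZFSet.{u}} (hA : A ⊆ V_ θ) :
    ∃ e : StrongnessEmbedding κ θ, e.IsSeeded ∧ A ∈ e.hull := by
  obtain ⟨t, ht⟩ := Ordinal.exists_isFundamentalSeq (o := θ) rfl
  have hlt : ∀ x ∈ V_ θ, ∃ α : Set.Iio θ.cof.ord, x ∈ V_ (t α : Ordinal.{u}) := by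
    intro x hx
    rw [ZFSet.mem_vonNeumann] at hx
    obtain ⟨_, ⟨α, rfl⟩, hα⟩ := ht.isCofinal_range ⟨_, hθ.succ_lt hx⟩
    exact ⟨α, ZFSet.mem_vonNeumann.2 (Order.succ_le_iff.1 hα)⟩
  let τ : Ordinal.{u} → Ordinal.{u} := fun α => if h : α < θ.cof.ord then t ⟨α, h⟩ else 0
  have hτ : ∀ α : Set.Iio θ.cof.ord, τ α = t α := fun α => dif_pos α.2
  have hτθ : ∀ α < θ.cof.ord, V_ (τ α) ∈ V_ θ := fun α hα => by
    rw [hτ ⟨α, hα⟩]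
    exact ZFSet.vonNeumann_mem_of_lt (t ⟨α, hα⟩).2
  -- The first component of each target is a piece of `A`. The second puts `V_ (τ α)` into `j(V_κ)`,
  -- so that `V_θ ⊆ j(V_κ)`.
  obtain ⟨e, he⟩ := hℓ.2 (fun α => ZFSet.pair (A ∩ V_ (τ α)) (V_ (τ α))) fun α hα =>
    pair_mem_vonNeumann hθ (ZFSet.mem_vonNeumann_of_subset
      (fun z hz => (ZFSet.mem_inter.1 hz).2) (hτθ α hα)) (hτθ α hα)
  have hs : e.IsSeeded := by
    refine ⟨hθ, fun x hx => ?_⟩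
    obtain ⟨α, hα⟩ := hlt x hx
    have hT := e.isTransitive_app (ZFSet.isTransitive_vonNeumann κ.ord)
    have h1 := (mem_of_pair_mem hT (mem_app_of_pair_mem_app (hℓ.1 α α.2).1 (he α α.2))).2
    rw [hτ] at h1
    exact hT _ h1 hα
  refine ⟨e, hs, ?_⟩
  have hk : κ.ord.toZFSet ∈ V_ θ := by rwa [ZFSet.mem_vonNeumann, Ordinal.rank_toZFSet]
  obtain ⟨w, hw, h⟩ := hs.hull_exists (P := fun s t _ x _ _ _ w => IsGuessedSet s t x w)
    inferInstance (s := θ.cof.ord.toZFSet) (t := sequenceGraph θ.cof.ord ℓ) (r := ∅)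
    (fun x _ _ _ => exists_isGuessedSet _ _ x) (hs.mem_hull hk) (hs.mem_hull hk) (hs.mem_hull hk)
    (hs.mem_hull hk)
  have : A = w := by
    ext z
    rw [h.mem_iff, isGuessed_iff (Cardinal.ord_le_ord.2 hcof)
      (fun α hα => ⟨_, _, (hℓ.1 α hα).1⟩) he]
    constructor
    · intro hz
      obtain ⟨α, hα⟩ := hlt z (hA hz)
      exact ⟨α, α.2, ZFSet.mem_inter.2 ⟨hz, by rwa [hτ]⟩⟩
    · rintro ⟨α, -, hz⟩
      exact (ZFSet.mem_inter.1 hz).1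
  rwa [this]

/-- The family is coded as one set of pairs `(i, z)` with `z ∈ E i`, a subset of `V_θ` because `θ`
is a limit; the hull then contains all its sections. -/
theorem IsJointLaverSequence.exists_forall_mem_hull {ℓ : Ordinal.{u} → ZFSet.{u}}
    (hℓ : IsJointLaverSequence κ θ θ.cof.ord ℓ) (hθ : Order.IsSuccLimit θ) (hcof : θ.cof ≤ κ)
    (hκ : κ.ord < θ) {E : ZFSet.{u} → ZFSet.{u}} (hE : ∀ i ∈ V_ θ, E i ⊆ V_ θ) :
    ∃ e : StrongnessEmbedding κ θ, e.IsSeeded ∧ ∀ i ∈ V_ θ, E i ∈ e.hull := by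
  obtain ⟨e, he, hA⟩ := hℓ.exists_mem_hull hθ hcof hκ
    (A := ZFSet.sep (fun c => snd c ∈ E (fst c)) (V_ θ)) ZFSet.sep_subset
  refine ⟨e, he, fun i hi => he.section_mem_hull hA hi fun z => ?_⟩
  rw [ZFSet.mem_sep, fst_pair, snd_pair]
  exact ⟨fun hz => ⟨he.pair_mem hi (hE i hi hz), hz⟩, fun h => h.2⟩

/-- By induction, choose for each `β < α` an extender of rank at least `β`. There are at most `ℶ_θ`
of them, so they are indexed by elements of `V_θ` and lie below one extender. -/
theorem IsJointLaverSequence.exists_le_rank {ℓ : Ordinal.{u} → ZFSet.{u}}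
    (hℓ : IsJointLaverSequence κ θ θ.cof.ord ℓ) (hθ : Order.IsSuccLimit θ) (hcof : θ.cof ≤ κ)
    (hκ : κ.ord < θ) [IsWellFounded _ (MitchellOrder κ θ)] (α : Ordinal.{u})
    (hα : α < (Order.succ (ℶ_ θ)).ord) : ∃ F : {E : ZFSet.{u} // IsExtender κ θ E},
      Ordinal.lift.{u + 1} α ≤ IsWellFounded.rank (MitchellOrder κ θ) F := by
  induction α using WellFoundedLT.induction with
  | ind α ih =>
    choose F hF using fun β : Set.Iio α => ih β β.2 (β.2.trans hα)
    -- `e₀` serves only to compute the cardinality of `V_θ`.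
    obtain ⟨e₀, -, -⟩ := hℓ.exists_mem_hull hθ hcof hκ (ZFSet.empty_subset (V_ θ))
    have hcard : #(Set.Iio α) ≤ #(V_ θ) := by
      rw [Cardinal.mk_Iio_ordinal, ZFSet.cardinalMk_coe_sort, e₀.card_vonNeumann_eq hκ,
        Cardinal.lift_le]
      exact Order.lt_succ_iff.1 (Cardinal.lt_ord.1 hα)
    obtain ⟨f⟩ := hcard
    have hf : Function.Injective fun β => (f β : ZFSet.{u}) :=
      Subtype.val_injective.comp f.injective
    obtain ⟨e, he, h⟩ := hℓ.exists_forall_mem_hull hθ hcof hκ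
      (E := Function.extend (fun β => (f β : ZFSet.{u})) (fun β => (F β).1) fun _ => ∅) (by
        intro i _
        by_cases hi : ∃ β, (f β : ZFSet.{u}) = i
        · obtain ⟨β, rfl⟩ := hi
          rw [hf.extend_apply]
          obtain ⟨e', -, h'⟩ := (F β).2
          rw [h']
          exact derivedExtender_subset hθ hκ
        · rw [Function.extend_apply' _ _ _ hi]
          exact ZFSet.empty_subset _)
    refine ⟨⟨derivedExtender e, e, he.subset, rfl⟩, le_of_forall_lt fun β' hβ' => ?_⟩
    obtain ⟨β, hβ, rfl⟩ := Ordinal.lt_lift_iff.1 hβ'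
    refine (hF ⟨β, hβ⟩).trans_lt (IsWellFounded.rank_lt_of_rel ?_)
    unfold MitchellOrder
    rw [he.mem_collapsedUltrapower_iff]
    have hm := h _ (f ⟨β, hβ⟩).2
    rw [hf.extend_apply] at hm
    refine ⟨_, hm, he.collapse_eq_self_of_subset ?_⟩
    obtain ⟨e', -, h'⟩ := (F ⟨β, hβ⟩).2
    rw [h']
    exact derivedExtender_subset hθ hκ

end StrongLaver

end

theorem mainTheorem6 (κ : Cardinal.{u}) (θ : Ordinal.{u})
    (hstrong : StrongLaver.IsStrong κ θ)
    (hlimit : Order.IsSuccLimit θ)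
    (hcof : θ.cof ≤ κ)
    (hlt : κ.ord < θ)
    (hjoint : ∃ ℓ : Ordinal.{u} → ZFSet.{u},
      StrongLaver.IsJointLaverSequence κ θ θ.cof.ord ℓ) :
    StrongLaver.HasMaximalMitchellRank κ θ := by
  obtain ⟨ℓ, hℓ⟩ := hjoint
  have hwf := StrongLaver.isWellFounded_mitchellOrder hlimit hlt
  refine ⟨hwf, le_antisymm ?_ ?_⟩
  · exact Ordinal.iSup_le fun F =>
      Order.succ_le_of_lt (StrongLaver.rank_mitchellOrder_lt hlimit hlt F)
  · refine le_of_forall_lt fun α' hα' => ?_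
    obtain ⟨α, hα, rfl⟩ := Ordinal.lt_lift_iff.1 hα'
    obtain ⟨F, hF⟩ := hℓ.exists_le_rank hlimit hcof hlt α hα
    exact (Order.lt_succ_of_le hF).trans_le (Ordinal.le_iSup (fun E =>
      Order.succ (IsWellFounded.rank (StrongLaver.MitchellOrder κ θ) E)) F)
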